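/- **Setting.** Let $n\ge 1$, let $B^0=(b^0_{ij})$ be an $n\times n$ integer matrix and let $D=\mathrm{diag}(d_1,\dots,d_n)$, with positive integers $d_i$, be such that $DB^0$ is skew-symmetric. Let $\Lambda$ be any skew-symmetric $n\times n$ integer matrix. Write $[x]_+=\max(x,0)$. Let $\mathbb T_n$ be the $n$-regular tree with edges labelled by $1,\dots,n$ so that the edges at each vertex have distinct labels, and fix a vertex $t_0$. The based quantum torus of a skew-symmetric integer form $\Omega$ on a lattice is the $\mathbb Z[q^{\pm 1/2}]$-algebra with basis $X^{\mathbf e}$ and product $X^{\mathbf e}X^{\mathbf f}=q^{\Omega(\mathbf e,\mathbf f)/2}X^{\mathbf e+\mathbf f}$. Let $\tilde B^0=\binom{B^0}{I}$, with columns $\tilde{\mathbf b}^1,\dots,\tilde{\mathbf b}^n$, let $$\Lambda_0=\begin{pmatrix}\Lambda & -\Lambda B^0-D\\ -(B^0)^T\Lambda+D & (B^0)^T\Lambda B^0+(B^0)^TD\end{pmatrix},$$ let $\mathcal F$ be the skew-field of fractions of the quantum torus of $\Lambda_0$ on $\mathbb Z^{2n}$, and let $M_0(\mathbf c)=X^{\mathbf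 c}$. The quantum seeds $(M_t,\tilde B^t=(b^t_{ij}))$, $t\in\mathbb T_n$, of the quantum cluster algebra with principal coefficients are obtained from $(M_{t_0},\tilde B^{t_0})=(M_0,\tilde B^0)$ by mutation along the edges. Mutation of $(M,(b_{ij}))$ in direction $k$ gives $(M',(b'_{ij}))$, where $b'_{ij}=-b_{ij}$ if $i=k$ or $j=k$, and $b'_{ij}=b_{ij}+\mathrm{sgn}(b_{ik})[b_{ik}b_{kj}]_+$ otherwise, and $$M'(\mathbf c)=\sum_{p=0}^{c_k}\binom{c_k}{p}_{q^{d_k/2}}M(E\mathbf c+p\,\mathbf b^k)\quad(c_k\ge 0),\qquad M'(-\mathbf c)=M'(\mathbf c)^{-1};$$ here $\mathbf b^k$ is the $k$-th column of $(b_{ij})$, $E\mathbf e_j=\mathbf e_j$ for $j\ne k$, $E\mathbf e_k=-\mathbf e_k+\sum_{i\neq k}[-b_{ik}]_+\mathbf e_i$, and $\binom{r}{p}_{v}=\prod_{i=0}^{p-1}\frac{v^{r-i}-v^{-(r-i)}}{v^{i+1}-v^{-(i+1)}}$. Let $X_{j;t}=M_t(\mathbf e_j)$, and let $\Lambda_t$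 be the integer matrix with $X_{i;t}X_{j;t}=q^{\Lambda_t(\mathbf e_i,\mathbf e_j)}X_{j;t}X_{i;t}$ for $i,j\in[1,2n]$. For $j\in[1,n]$ let $\mathbf g_{j;t}\in\mathbb Z^n$ be the $\mathbf g$-vector: the degree of the cluster variable $x_{j;t}$ of the ordinary (nonquantum) cluster algebra with principal coefficients and initial exchange matrix $\tilde B^0$, for the grading $\deg x_i=\mathbf e_i$, $\deg y_j=-(j\text{-th column of }B^0)$. It is regarded as an element of $\mathbb Z^{2n}$ by appending $n$ zeros; put $\mathbf g_{n+j;t}=\mathbf e_{n+j}$. Let $$\rho^t_{ij}=\Lambda_t(\mathbf e_i,\mathbf e_j)-\Lambda_0(\mathbf g_{i;t},\mathbf g_{j;t})\qquad (i,j\in[1,2n]).$$ Let $R$ be the quantum torus on $\mathbb Z^n$, with basis denoted $Z^{\mathbf c}$, of the form with matrix $(d_ib^0_{ij})$, and let $\mathcal F(R)$ be its skew-field of fractions. For $F\in\mathcal F(R)$ let $F(\hat Y)\in\mathcal F$ be its image under the homomorphism $Z^{\mathbf c}\mapsto M_0(\tilde B^0\mathbf c)$. The quantum $F$-polynomial $F_{j;t}$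 is the element of $\mathcal F(R)$ (known to be a polynomial in $Z_1,\dots,Z_n$ over $\mathbb Z[q^{\pm1/2}]$) that is determined by $$X_{j;t}=F_{j;t}(\hat Y)\,M_0(\mathbf g_{j;t}).$$ For $\mathbf a\in\mathbb Z^n$ let $L[\mathbf a]$ be the $\mathbb Z[q^{\pm1/2}]$-linear automorphism of $R$ with $L[\mathbf a](Z^{\mathbf b})=q^{-\sum_i a_ib_id_i}Z^{\mathbf b}$, extended to $\mathcal F(R)$. For an edge of $\mathbb T_n$ with label $k$ between $t$ and $t'$, a sign $\epsilon\in\{+,-\}$, $b_{ij}=b^t_{ij}$, and $j\in[1,n]$, put $$G_j^{(\epsilon)}=\prod^{\rightarrow}_{i\in[1,[\epsilon b_{jk}]_+]}L[(i-1)\mathbf g_{j;t}](F_{j;t}),\qquad \hat F_{j;t}^{\{[\epsilon b_{jk}]_+\}}=L\Big[-\mathbf g_{k;t}+\sum_{i=1}^{j-1}[\epsilon b_{ik}]_+\mathbf g_{i;t}\Big]\big(G_j^{(\epsilon)}\big),$$ (so that the latter is $1$ for $j=k$), $\hat F_{k;t}^{\{-1\}}=\big(L[-\mathbf g_{k;t}](F_{k;t})\big)^{-1}$,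 where $\prod^{\rightarrow}$ is the product in increasing order of the index, and $$\rho^\epsilon=\tfrac12\Big(-\sum_{i=1}^{2n}[\epsilon b_{ik}]_+\rho^t_{ik}+\sum_{1\le i<j\le n}[\epsilon b_{ik}]_+[\epsilon b_{jk}]_+\rho^t_{ji}+\sum_{i,j=1}^n[\epsilon b_{ik}]_+[\epsilon b_{n+j,k}]_+\rho^t_{n+j,i}\Big),$$ $$\lambda^\epsilon=\tfrac12\sum_{i=1}^n[\epsilon b_{n+i,k}]_+\,g'_i\,d_i,\qquad \mathbf g_{k;t'}=(g'_1,\dots,g'_n).$$ **Theorem.** For all $j$ and $t$ there is exactly one $F_{j;t}\in\mathcal F(R)$ with $X_{j;t}=F_{j;t}(\hat Y)M_0(\mathbf g_{j;t})$, and these elements satisfy the following recurrence. Initially, $F_{j;t_0}=1$ for all $j\in[1,n]$. If $t$ and $t'$ are joined by an edge of $\mathbb T_n$ with label $k$, then $F_{j;t'}=F_{j;t}$ for $j\neq k$, and $$F_{k;t'}=\sum_{\epsilon\in\{+,-\}}q^{\rho^\epsilon-\lambda^\epsilon}\,\hat F_{k;t}^{\{-1\}}\Big(\prod^{\rightarrow}_{i\in[1,n]}\hat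 F_{i;t}^{\{[\epsilon b_{ik}]_+\}}\Big)Z^{\sum_{\ell=1}^n[\epsilon b_{n+\ell,k}]_+\mathbf e_\ell}.$$ -/

import Mathlib

open scoped Matrix nonZeroDivisors

noncomputable section

namespace QCA

/-- The monomials `q^(a/2) X^e` (`a : ℤ`, `e : ℤ^ι`) of the based quantum torus whose
quasi-commutation matrix is `Λ`.  They form a group under
`q^(a/2) X^e * q^(b/2) X^f = q^((a + b + Λ(e, f))/2) X^(e + f)`. -/
@[ext]
structure QMonomial {ι : Type} [Fintype ι] (Λ : Matrix ι ι ℤ) where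
  /-- the exponent of `q^(1/2)` -/
  a : ℤ
  /-- the exponent vector of `X` -/
  e : ι → ℤ

namespace QMonomial

variable {ι : Type} [Fintype ι] {Λ : Matrix ι ι ℤ}

instance : Mul (QMonomial Λ) := ⟨fun x y => ⟨x.a + y.a + x.e ⬝ᵥ Λ *ᵥ y.e, x.e + y.e⟩⟩
instance : One (QMonomial Λ) := ⟨⟨0, 0⟩⟩
instance : Inv (QMonomial Λ) := ⟨fun x => ⟨x.e ⬝ᵥ Λ *ᵥ x.e - x.a, -x.e⟩⟩

theorem mul_a (x y : QMonomial Λ) : (x * y).a = x.a + y.a + x.e ⬝ᵥ Λ *ᵥ y.e := rfl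
theorem mul_e (x y : QMonomial Λ) : (x * y).e = x.e + y.e := rfl
theorem one_a : (1 : QMonomial Λ).a = 0 := rfl
theorem one_e : (1 : QMonomial Λ).e = 0 := rfl
theorem inv_a (x : QMonomial Λ) : (x⁻¹).a = x.e ⬝ᵥ Λ *ᵥ x.e - x.a := rfl
theorem inv_e (x : QMonomial Λ) : (x⁻¹).e = -x.e := rfl

instance : Group (QMonomial Λ) :=
  Group.ofLeftAxioms
    (by
      intro x y z
      ext1
      · simp only [mul_a, mul_e, Matrix.mulVec_add, dotProduct_add, add_dotProduct]; ring
      · simp only [mul_e, add_assoc])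
    (by intro x; ext1 <;> simp [mul_a, mul_e, one_a, one_e])
    (by intro x; ext1 <;> simp [mul_a, mul_e, one_a, one_e, inv_a, inv_e])

instance : UniqueProds (QMonomial Λ) where
  uniqueMul_of_nonempty {A B} hA hB := by
    classical
    obtain ⟨e0, he0, f0, hf0, hu⟩ := UniqueSums.uniqueAdd_of_nonempty
      (hA.image QMonomial.e) (hB.image QMonomial.e)
    obtain ⟨x0, hx0, rfl⟩ := Finset.mem_image.1 he0
    obtain ⟨y0, hy0, rfl⟩ := Finset.mem_image.1 hf0
    obtain ⟨x, hx, hxm⟩ := (A.filter fun z => z.e = x0.e).exists_max_image QMonomial.a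
      ⟨x0, by simp [hx0]⟩
    obtain ⟨y, hy, hym⟩ := (B.filter fun z => z.e = y0.e).exists_max_image QMonomial.a
      ⟨y0, by simp [hy0]⟩
    rw [Finset.mem_filter] at hx hy
    refine ⟨x, hx.1, y, hy.1, ?_⟩
    intro z w hz hw h
    have he : z.e + w.e = x0.e + y0.e := by
      rw [← hx.2, ← hy.2, ← mul_e, ← mul_e, h]
    obtain ⟨h1, h2⟩ := hu (Finset.mem_image_of_mem _ hz) (Finset.mem_image_of_mem _ hw) he
    have hz1 := hxm z (by simp [hz, h1])
    have hw1 := hym w (by simp [hw, h2])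
    have ha : (z * w).a = (x * y).a := by rw [h]
    rw [mul_a, mul_a, h1, h2, hx.2, hy.2] at ha
    constructor
    · ext1
      · omega
      · rw [h1, hx.2]
    · ext1
      · omega
      · rw [h2, hy.2]

/-- The monomials whose exponents of `q^(1/2)` and of `X` are bounded by `K` and `N`. -/
def box (Λ : Matrix ι ι ℤ) (K N : ℕ) : Finset (QMonomial Λ) :=
  open scoped Classical in
  (Finset.Icc (-(K : ℤ)) K ×ˢ Fintype.piFinset fun _ : ι => Finset.Icc (-(N : ℤ)) (N : ℤ)).image
    fun p => (⟨p.1, p.2⟩ : QMonomial Λ)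

theorem mem_box {K N : ℕ} {x : QMonomial Λ} :
    x ∈ box Λ K N ↔ |x.a| ≤ K ∧ ∀ i, |x.e i| ≤ N := by
  classical
  simp only [box, Finset.mem_image, Finset.mem_product, Finset.mem_Icc, Fintype.mem_piFinset,
    abs_le]
  constructor
  · rintro ⟨p, hp, rfl⟩; exact hp
  · intro h; exact ⟨(x.a, x.e), h, rfl⟩

theorem card_box (K N : ℕ) :
    (box Λ K N).card = (2 * K + 1) * (2 * N + 1) ^ Fintype.card ι := by
  classical
  rw [box, Finset.card_image_of_injective _ (fun p p' h => by
    simpa [Prod.ext_iff] using h)]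
  have h : ∀ M : ℕ, ((M : ℤ) + 1 + (M : ℤ)).toNat = 2 * M + 1 := by intro M; omega
  simp [Finset.card_product, Fintype.card_piFinset, h]

theorem exists_small_growth (X : Finset (QMonomial Λ)) :
    ∃ S S' : Finset (QMonomial Λ), (∀ h ∈ S, ∀ x ∈ X, h * x ∈ S') ∧ S'.card < 2 * S.card := by
  classical
  obtain ⟨C, hC⟩ : ∃ C : ℕ, ∀ x ∈ X, |x.a| ≤ C ∧ (∀ i, |x.e i| ≤ C) ∧
      ∑ i, |(Λ *ᵥ x.e) i| ≤ C := by
    refine ⟨∑ x ∈ X, (x.a.natAbs + ∑ i, (x.e i).natAbs + ∑ i, ((Λ *ᵥ x.e) i).natAbs), ?_⟩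
    intro x hx
    have h1 := Finset.single_le_sum (f := fun x : QMonomial Λ =>
      (x.a.natAbs + ∑ i, (x.e i).natAbs + ∑ i, ((Λ *ᵥ x.e) i).natAbs))
      (fun _ _ => Nat.zero_le _) hx
    refine ⟨?_, ?_, ?_⟩
    · have : x.a.natAbs ≤ _ := le_trans (by omega) h1
      rw [Int.abs_eq_natAbs]; exact_mod_cast this
    · intro i
      have h2 := Finset.single_le_sum (f := fun i => (x.e i).natAbs)
        (fun _ _ => Nat.zero_le _) (Finset.mem_univ i)
      have : (x.e i).natAbs ≤ _ := le_trans (by omega) h1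
      rw [Int.abs_eq_natAbs]; exact_mod_cast this
    · have : ∑ i, ((Λ *ᵥ x.e) i).natAbs ≤ _ := le_trans (by omega) h1
      simp only [Int.abs_eq_natAbs]; exact_mod_cast this
  set m := Fintype.card ι
  obtain ⟨N, hN⟩ : ∃ N : ℕ, (2 * (N * N + C + N * C) + 1) * (2 * (N + C) + 1) ^ m
      < 2 * ((2 * (N * N) + 1) * (2 * N + 1) ^ m) := by
    have hc : ∀ᶠ x : ℝ in nhds 0,
        (2 * (1 + C * x ^ 2 + C * x) + x ^ 2) * (2 * (1 + C * x) + x) ^ m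
          < 2 * ((2 + x ^ 2) * (2 + x) ^ m) := by
      refine ContinuousAt.eventually_lt (by fun_prop) (by fun_prop) ?_
      simp
    have ht := tendsto_one_div_atTop_nhds_zero_nat (𝕜 := ℝ)
    obtain ⟨N, hN, hN0⟩ := ((ht.eventually hc).and (Filter.eventually_gt_atTop 0)).exists
    refine ⟨N, ?_⟩
    have hN0' : (0 : ℝ) < N := by exact_mod_cast hN0
    have hN' := mul_lt_mul_of_pos_right hN (pow_pos hN0' (m + 2))
    have e1 : (2 * (1 + C * (1 / (N : ℝ)) ^ 2 + C * (1 / (N : ℝ))) + (1 / (N : ℝ)) ^ 2) *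
        (2 * (1 + C * (1 / (N : ℝ))) + 1 / (N : ℝ)) ^ m * (N : ℝ) ^ (m + 2)
        = (2 * (N * N + C + N * C) + 1) * (2 * (N + C) + 1) ^ m := by
      rw [pow_add, mul_comm ((N : ℝ) ^ m), ← mul_assoc, mul_right_comm _ _ ((N : ℝ) ^ 2),
        mul_assoc _ _ ((N : ℝ) ^ m), ← mul_pow]
      congr 1
      · field_simp
      · congr 1; field_simp
    have e2 : 2 * ((2 + (1 / (N : ℝ)) ^ 2) * (2 + 1 / (N : ℝ)) ^ m) * (N : ℝ) ^ (m + 2)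
        = 2 * ((2 * (N * N) + 1) * (2 * N + 1) ^ m) := by
      rw [pow_add, mul_comm ((N : ℝ) ^ m), mul_assoc 2, mul_assoc (2 + _), mul_left_comm _ (_ ^ 2),
        ← mul_pow, ← mul_assoc (2 + _)]
      congr 1
      congr 1
      · field_simp
      · congr 1; field_simp
    rw [e1, e2] at hN'
    exact_mod_cast hN'
  refine ⟨box Λ (N * N) N, box Λ (N * N + C + N * C) (N + C), ?_, ?_⟩
  · intro h hh x hx
    obtain ⟨h1, h2⟩ := mem_box.1 hh
    obtain ⟨c1, c2, c3⟩ := hC x hx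
    rw [mem_box]
    constructor
    · have h3 : |h.e ⬝ᵥ Λ *ᵥ x.e| ≤ N * C := by
        calc |h.e ⬝ᵥ Λ *ᵥ x.e| ≤ ∑ i, |h.e i * (Λ *ᵥ x.e) i| := Finset.abs_sum_le_sum_abs _ _
          _ ≤ ∑ i, N * |(Λ *ᵥ x.e) i| := by
            refine Finset.sum_le_sum fun i _ => ?_
            rw [abs_mul]
            exact mul_le_mul_of_nonneg_right (h2 i) (abs_nonneg _)
          _ = N * ∑ i, |(Λ *ᵥ x.e) i| := by rw [Finset.mul_sum]
          _ ≤ N * C := mul_le_mul_of_nonneg_left c3 (by positivity)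
      rw [mul_a]
      push_cast at h1 ⊢
      have := abs_add_three h.a x.a (h.e ⬝ᵥ Λ *ᵥ x.e)
      linarith
    · intro i
      rw [mul_e, Pi.add_apply]
      push_cast
      exact (abs_add_le _ _).trans (add_le_add (h2 i) (c2 i))
  · rw [card_box, card_box]; exact hN

end QMonomial

/-- The based quantum torus with quasi-commutation matrix `Λ`: the `ℤ[q^(±1/2)]`-algebra with
`ℤ[q^(±1/2)]`-basis `X^e` (`e : ℤ^ι`) and `X^e * X^f = q^(Λ(e, f)/2) X^(e + f)`.  Its `ℤ`-basis is
the group of all `q^(a/2) X^e`, so it is the integral group ring of that group. -/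
abbrev QTorus {ι : Type} [Fintype ι] (Λ : Matrix ι ι ℤ) : Type := MonoidAlgebra ℤ (QMonomial Λ)

/-- The (left) Ore condition for the quantum torus. -/
theorem QTorus.ore {ι : Type} [Fintype ι] {Λ : Matrix ι ι ℤ} (r : QTorus Λ)
    (s : (QTorus Λ)⁰) : ∃ r' : QTorus Λ, ∃ s' : (QTorus Λ)⁰, (s' : QTorus Λ) * r = r' * s := by
  classical
  obtain ⟨S, S', hS, hc⟩ := QMonomial.exists_small_growth (r.coeff.support ∪ (s : QTorus Λ).coeff.support)
  let u : (S → ℤ) → QTorus Λ := fun f => ∑ h, MonoidAlgebra.single h.1 (f h)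
  have hu : ∀ f : S → ℤ, u f = 0 → f = 0 := by
    intro f hf
    ext h
    have h1 : (u f).coeff h.1 = f h := by
      simp only [u, MonoidAlgebra.coeff_sum, MonoidAlgebra.coeff_single, Finsupp.finsetSum_apply]
      rw [Finset.sum_eq_single h]
      · simp
      · intro b _ hb
        exact Finsupp.single_eq_of_ne (fun h' => hb (Subtype.ext h'.symm))
      · simp
    rw [← h1, hf]; rfl
  have hadd : ∀ f g, u (f + g) = u f + u g := by
    intro f g; simp [u, MonoidAlgebra.single_add, Finset.sum_add_distrib]
  have hsmul : ∀ (c : ℤ) f, u (c • f) = c • u f := by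
    intro c f; simp [u, Finset.smul_sum, MonoidAlgebra.smul_single]
  have hsupp : ∀ (f : S → ℤ) (x : QTorus Λ),
      x.coeff.support ⊆ r.coeff.support ∪ (s : QTorus Λ).coeff.support →
      ∀ g, g ∉ S' → (u f * x).coeff g = 0 := by
    intro f x hx g hg
    simp only [u, Finset.sum_mul, MonoidAlgebra.coeff_sum, Finsupp.finsetSum_apply]
    refine Finset.sum_eq_zero fun h _ => ?_
    rw [MonoidAlgebra.coeff_single_mul_apply]
    by_contra hne
    have h2 : h.1⁻¹ * g ∈ x.coeff.support := by
      rw [Finsupp.mem_support_iff]; exact right_ne_zero_of_mul hne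
    have := hS h.1 h.2 _ (hx h2)
    rw [mul_inv_cancel_left] at this
    exact hg this
  let φ : ((S ⊕ S) → ℤ) →ₗ[ℤ] (S' → ℤ) :=
    { toFun := fun f g =>
        (u (fun h => f (Sum.inl h)) * r - u (fun h => f (Sum.inr h)) * s).coeff g.1
      map_add' := by
        intro f f'
        ext g
        have h1 := hadd (fun h => f (Sum.inl h)) (fun h => f' (Sum.inl h))
        have h2 := hadd (fun h => f (Sum.inr h)) (fun h => f' (Sum.inr h))
        change (u ((fun h => f (Sum.inl h)) + fun h => f' (Sum.inl h)) * r
          - u ((fun h => f (Sum.inr h)) + fun h => f' (Sum.inr h)) * s).coeff g.1 = _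
        rw [h1, h2]
        simp only [add_mul, MonoidAlgebra.coeff_sub, MonoidAlgebra.coeff_add, Finsupp.sub_apply,
          Finsupp.add_apply, Pi.add_apply]
        ring
      map_smul' := by
        intro c f
        ext g
        change (u (c • fun h => f (Sum.inl h)) * r
          - u (c • fun h => f (Sum.inr h)) * s).coeff g.1 = _
        rw [hsmul, hsmul, smul_mul_assoc, smul_mul_assoc, ← smul_sub]
        rfl }
  have hφ : ¬ Function.Injective φ := by
    intro hi
    have := card_le_of_injective ℤ φ hi
    simp only [Fintype.card_sum, Fintype.card_coe] at this
    omega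
  obtain ⟨f, hf, hf0⟩ : ∃ f, φ f = 0 ∧ f ≠ 0 := by
    by_contra! h
    exact hφ ((injective_iff_map_eq_zero φ).2 h)
  have heq : u (fun h => f (Sum.inl h)) * r = u (fun h => f (Sum.inr h)) * s := by
    rw [← sub_eq_zero]
    refine MonoidAlgebra.coeff_injective (Finsupp.ext fun g => ?_)
    by_cases hg : g ∈ S'
    · exact congrFun hf ⟨g, hg⟩
    · rw [MonoidAlgebra.coeff_sub, Finsupp.sub_apply, hsupp _ _ Finset.subset_union_left g hg,
        hsupp _ _ Finset.subset_union_right g hg]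
      rfl
  refine ⟨_, ⟨u (fun h => f (Sum.inl h)), mem_nonZeroDivisors_of_ne_zero ?_⟩, heq⟩
  intro h0
  rw [h0, zero_mul, eq_comm, mul_eq_zero] at heq
  have h1 := hu _ h0
  have h2 := hu _ (heq.resolve_right (nonZeroDivisors.coe_ne_zero s))
  refine hf0 (funext fun x => ?_)
  rcases x with x | x
  · exact congrFun h1 x
  · exact congrFun h2 x

instance {ι : Type} [Fintype ι] (Λ : Matrix ι ι ℤ) : OreLocalization.OreSet (QTorus Λ)⁰ where
  ore_right_cancel r₁ r₂ s h := by
    refine ⟨1, ?_⟩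
    rw [mul_right_cancel₀ (nonZeroDivisors.coe_ne_zero s) h]
  oreNum r s := (QTorus.ore r s).choose
  oreDenom r s := (QTorus.ore r s).choose_spec.choose
  ore_eq r s := (QTorus.ore r s).choose_spec.choose_spec

/-- The skew-field of fractions of the quantum torus. -/
abbrev QSkewField {ι : Type} [Fintype ι] (Λ : Matrix ι ι ℤ) : Type :=
  OreLocalization (QTorus Λ)⁰ (QTorus Λ)

namespace QSkewField

variable {ι κ : Type} [Fintype ι] [Fintype κ]

/-- The inclusion of the quantum torus into its skew-field of fractions. -/
def incl (Λ : Matrix ι ι ℤ) : QTorus Λ →+* QSkewField Λ := OreLocalization.numeratorRingHom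

theorem incl_injective (Λ : Matrix ι ι ℤ) : Function.Injective (incl Λ) :=
  OreLocalization.numeratorHom_inj inf_le_left

/-- The element `q^(1/2)`. -/
def qHalf (Λ : Matrix ι ι ℤ) : QSkewField Λ := incl Λ (MonoidAlgebra.single ⟨1, 0⟩ 1)

/-- The basis element `X^e`. -/
def X (Λ : Matrix ι ι ℤ) (e : ι → ℤ) : QSkewField Λ := incl Λ (MonoidAlgebra.single ⟨0, e⟩ 1)

/-- The homomorphism of skew-fields of fractions induced by an injective homomorphism of the
groups of monomials. -/
def map {Λ : Matrix ι ι ℤ} {Λ' : Matrix κ κ ℤ} (f : QMonomial Λ →* QMonomial Λ')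
    (hf : Function.Injective f) : QSkewField Λ →+* QSkewField Λ' :=
  have h : ∀ s : (QTorus Λ)⁰, (incl Λ').comp (MonoidAlgebra.mapDomainRingHom ℤ f) s ≠ 0 := by
    intro s hs
    refine nonZeroDivisors.coe_ne_zero s
      (MonoidAlgebra.mapDomain_injective hf (incl_injective Λ' ?_))
    simpa using hs
  OreLocalization.universalHom ((incl Λ').comp (MonoidAlgebra.mapDomainRingHom ℤ f))
    { toFun := fun s => Units.mk0 _ (h s)
      map_one' := by ext; simp
      map_mul' := fun s s' => Units.ext (map_mul _ (s : QTorus Λ) s') }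
    (fun _ => rfl)

end QSkewField

/-! ### The tree -/

/-- The vertices of the `n`-regular tree `𝕋_n` with edges labelled by `1, …, n`, as reduced words:
the vertex `[k_r, …, k_1]` is the end of the path that starts at the initial vertex `t₀` and whose
successive edges have the labels `k_1, …, k_r` (consecutive labels being distinct). -/
def TreeVertex (n : ℕ) : Type := {w : List (Fin n) // w.IsChain (· ≠ ·)}

/-- The initial vertex `t₀`. -/
def TreeVertex.root (n : ℕ) : TreeVertex n := ⟨[], List.isChain_nil⟩

/-- `t` and `t'` are joined by an edge with label `k`. -/
def TreeVertex.Edge {n : ℕ} (k : Fin n) (t t' : TreeVertex n) : Prop :=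
  t'.1 = k :: t.1 ∨ t.1 = k :: t'.1

/-! ### Matrices and nonquantum seeds with principal coefficients -/

/-- The index set `[1, 2n]`: `Sum.inl i` stands for `i`, and `Sum.inr j` for `n + j`. -/
abbrev Idx (n : ℕ) : Type := Fin n ⊕ Fin n

/-- `[x]_+ = max(x, 0)`. -/
def plusPart (x : ℤ) : ℤ := max x 0

/-- Matrix mutation in direction `k`. -/
def mutMatrix {n : ℕ} (k : Fin n) (b : Matrix (Idx n) (Fin n) ℤ) : Matrix (Idx n) (Fin n) ℤ :=
  Matrix.of fun i j =>
    if i = Sum.inl k ∨ j = k then -b i j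
    else b i j + (b i k).sign * plusPart (b i k * b (Sum.inl k) j)

/-- The principal matrix corresponding to `B`: `B` on top of the identity matrix. -/
def principalMatrix {n : ℕ} (B : Matrix (Fin n) (Fin n) ℤ) : Matrix (Idx n) (Fin n) ℤ :=
  Matrix.fromRows B 1

/-- The ambient field of the nonquantum cluster algebra with principal coefficients: rational
functions in `x_1, …, x_n` (indices `Sum.inl i`) and `y_1, …, y_n` (indices `Sum.inr j`). -/
abbrev ClusterField (n : ℕ) : Type := FractionRing (MvPolynomial (Idx n) ℤ)

/-- An extended cluster with an extended exchange matrix. -/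
structure ClusterSeed (n : ℕ) where
  /-- the extended cluster -/
  x : Idx n → ClusterField n
  /-- the exchange matrix -/
  b : Matrix (Idx n) (Fin n) ℤ

/-- Seed mutation in direction `k`. -/
def ClusterSeed.mutate {n : ℕ} (k : Fin n) (s : ClusterSeed n) : ClusterSeed n where
  x := Function.update s.x (Sum.inl k)
    ((s.x (Sum.inl k))⁻¹ *
      (∏ i, s.x i ^ plusPart (s.b i k) + ∏ i, s.x i ^ plusPart (-s.b i k)))
  b := mutMatrix k s.b

/-- The seed with principal coefficients that is reached from the initial one by the mutations
along a path. -/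
def principalSeed {n : ℕ} (B : Matrix (Fin n) (Fin n) ℤ) : List (Fin n) → ClusterSeed n
  | [] => ⟨fun i => algebraMap (MvPolynomial (Idx n) ℤ) _ (MvPolynomial.X i), principalMatrix B⟩
  | k :: w => (principalSeed B w).mutate k

/-- The degrees `deg x_i = e_i`, `deg y_j = -(j-th column of B)`. -/
def gWeight {n : ℕ} (B : Matrix (Fin n) (Fin n) ℤ) : Idx n → Fin n → ℤ :=
  Sum.elim (fun i => Pi.single i 1) (fun j i => -B i j)

/-- `f` is a nonzero homogeneous element of degree `g`: a quotient of nonzero homogeneous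
polynomials whose degrees differ by `g`.  For Laurent polynomials in the `x_i` and `y_j` this is
homogeneity in the `ℤ^n`-graded ring of Laurent polynomials. -/
def HasDegree {n : ℕ} (B : Matrix (Fin n) (Fin n) ℤ) (f : ClusterField n) (g : Fin n → ℤ) : Prop :=
  ∃ (P Q : MvPolynomial (Idx n) ℤ) (a b : Fin n → ℤ), P ≠ 0 ∧ Q ≠ 0 ∧
    P.IsWeightedHomogeneous (gWeight B) a ∧ Q.IsWeightedHomogeneous (gWeight B) b ∧
    f = algebraMap _ (ClusterField n) P / algebraMap _ (ClusterField n) Q ∧ g = a - b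

/-- The `g`-vector of the cluster variable `x_{j;t}`: its degree. -/
def gVector {n : ℕ} (B : Matrix (Fin n) (Fin n) ℤ) (t : TreeVertex n) (j : Fin n) : Fin n → ℤ :=
  Classical.epsilon fun g => HasDegree B ((principalSeed B t.1).x (Sum.inl j)) g

/-- The extended `g`-vectors: `n` zeros are appended to the `g`-vectors of the cluster variables,
and that of the coefficient variable with index `n + j` is `e_{n+j}`. -/
def gVectorExt {n : ℕ} (B : Matrix (Fin n) (Fin n) ℤ) (t : TreeVertex n) : Idx n → Idx n → ℤ :=
  Sum.elim (fun j => Sum.elim (gVector B t j) 0) (fun j => Pi.single (Sum.inr j) 1)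

/-! ### The quantum cluster algebra with principal coefficients -/

section Quantum

variable {n : ℕ} (B : Matrix (Fin n) (Fin n) ℤ) (d : Fin n → ℤ) (Λ : Matrix (Fin n) (Fin n) ℤ)

/-- The matrix `Λ₀` of the initial quasi-commutation relations. -/
def lambda0 : Matrix (Idx n) (Idx n) ℤ :=
  Matrix.fromBlocks Λ (-(Λ * B) - Matrix.diagonal d)
    (-(Bᵀ * Λ) + Matrix.diagonal d) (Bᵀ * Λ * B + Bᵀ * Matrix.diagonal d)

/-- The ambient skew-field `𝓕`. -/
abbrev Ambient : Type := QSkewField (lambda0 B d Λ)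

/-- The initial toric frame `M₀`. -/
def frame0 (c : Idx n → ℤ) : Ambient B d Λ := QSkewField.X (lambda0 B d Λ) c

/-- The `t`-binomial coefficient
`((t^r - t^(-r)) ⋯ (t^(r-p+1) - t^(-r+p-1))) / ((t^p - t^(-p)) ⋯ (t - t^(-1)))`. -/
def tBinom {K : Type} [DivisionRing K] (t : K) (r p : ℕ) : K :=
  ((List.range p).map fun i : ℕ =>
    (t ^ ((r : ℤ) - i) - t ^ (-((r : ℤ) - i))) / (t ^ ((i : ℤ) + 1) - t ^ (-((i : ℤ) + 1)))).prod

/-- The matrix `E_ε` in direction `k`, for the sign `ε = +1`. -/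
def mutE (k : Fin n) (b : Matrix (Idx n) (Fin n) ℤ) : Matrix (Idx n) (Idx n) ℤ :=
  Matrix.of fun i j =>
    if j ≠ Sum.inl k then (if i = j then 1 else 0)
    else if i = j then -1 else max 0 (-b i k)

/-- A toric frame with an exchange matrix. -/
structure QuantumSeed where
  /-- the toric frame -/
  M : (Idx n → ℤ) → Ambient B d Λ
  /-- the exchange matrix -/
  b : Matrix (Idx n) (Fin n) ℤ

variable {B d Λ}

/-- `∑_p (c_k choose p)_{q^(d_k/2)} M(E c + p b^k)`, the value of the mutated toric frame at `c`
if `c_k ≥ 0`. -/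
def QuantumSeed.mutatePos (k : Fin n) (s : QuantumSeed B d Λ) (c : Idx n → ℤ) : Ambient B d Λ :=
  ∑ p ∈ Finset.range ((c (Sum.inl k)).toNat + 1),
    tBinom (QSkewField.qHalf (lambda0 B d Λ) ^ d k) (c (Sum.inl k)).toNat p *
      s.M (mutE k s.b *ᵥ c + (p : ℤ) • fun i => s.b i k)

/-- Mutation of quantum seeds in direction `k`. -/
def QuantumSeed.mutate (k : Fin n) (s : QuantumSeed B d Λ) : QuantumSeed B d Λ where
  M c := if 0 ≤ c (Sum.inl k) then s.mutatePos k c else (s.mutatePos k (-c))⁻¹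
  b := mutMatrix k s.b

/-- The quasi-commutation matrix of a toric frame: `X_i X_j = q^(λ_ij) X_j X_i`. -/
def frameForm (M : (Idx n → ℤ) → Ambient B d Λ) (i j : Idx n) : ℤ :=
  Classical.epsilon fun l : ℤ =>
    M (Pi.single i 1) * M (Pi.single j 1) =
      QSkewField.qHalf (lambda0 B d Λ) ^ (2 * l) * (M (Pi.single j 1) * M (Pi.single i 1))

variable (B d Λ)

/-- The quantum seed reached from the initial one by the mutations along a path. -/
def quantumSeed : List (Fin n) → QuantumSeed B d Λ
  | [] => ⟨frame0 B d Λ, principalMatrix B⟩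
  | k :: w => (quantumSeed w).mutate k

/-- The cluster variable `X_{j;t}`. -/
def clusterVar (t : TreeVertex n) (j : Fin n) : Ambient B d Λ :=
  (quantumSeed B d Λ t.1).M (Pi.single (Sum.inl j) 1)

/-- `ρ^t_{ij} = Λ_t(e_i, e_j) - Λ₀(g_{i;t}, g_{j;t})`. -/
def rho (t : TreeVertex n) (i j : Idx n) : ℤ :=
  frameForm (quantumSeed B d Λ t.1).M i j -
    gVectorExt B t i ⬝ᵥ lambda0 B d Λ *ᵥ gVectorExt B t j

/-! ### Quantum `F`-polynomials -/

/-- The matrix `(d_i b_ij)` of the quasi-commutation relations `Z_i Z_j = q^(d_i b_ij) Z_j Z_i`. -/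
def zForm : Matrix (Fin n) (Fin n) ℤ := Matrix.diagonal d * B

/-- The skew-field of fractions `𝓕(R)` of the quantum torus `R` in `Z_1, …, Z_n`. -/
abbrev ZField : Type := QSkewField (zForm B d)

/-- The monomial `Z^c`. -/
def zMon (c : Fin n → ℤ) : ZField B d := QSkewField.X (zForm B d) c

theorem principal_form :
    (principalMatrix B)ᵀ * lambda0 B d Λ * principalMatrix B = zForm B d := by
  have h : (principalMatrix B)ᵀ * lambda0 B d Λ =
      Matrix.fromCols (Matrix.diagonal d) (0 : Matrix (Fin n) (Fin n) ℤ) := by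
    rw [principalMatrix, lambda0, Matrix.transpose_fromRows, Matrix.fromCols_mul_fromBlocks]
    congr 1
    · simp
    · simp [Matrix.mul_sub, Matrix.mul_assoc]
  rw [h, principalMatrix, Matrix.fromCols_mul_fromRows, zForm]
  simp

/-- The substitution `Z^c ↦ M₀(B̃ c)` on monomials. -/
def yHatMonomial : QMonomial (zForm B d) →* QMonomial (lambda0 B d Λ) where
  toFun x := ⟨x.a, principalMatrix B *ᵥ x.e⟩
  map_one' := by ext1 <;> simp [QMonomial.one_a, QMonomial.one_e]
  map_mul' x y := by
    ext1
    · have h : ∀ u v : Fin n → ℤ, u ⬝ᵥ zForm B d *ᵥ v =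
          principalMatrix B *ᵥ u ⬝ᵥ lambda0 B d Λ *ᵥ principalMatrix B *ᵥ v := by
        intro u v
        rw [← principal_form B d Λ, ← Matrix.mulVec_mulVec, ← Matrix.mulVec_mulVec,
          Matrix.dotProduct_mulVec, Matrix.vecMul_transpose]
      simp only [QMonomial.mul_a, h]
    · simp only [QMonomial.mul_e, Matrix.mulVec_add]

theorem yHatMonomial_injective : Function.Injective (yHatMonomial B d Λ) := by
  intro x y h
  have ha : x.a = y.a := (QMonomial.ext_iff.1 h).1
  have he : principalMatrix B *ᵥ x.e = principalMatrix B *ᵥ y.e := (QMonomial.ext_iff.1 h).2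
  rw [principalMatrix, Matrix.fromRows_mulVec, Matrix.fromRows_mulVec] at he
  ext i
  · exact ha
  · simpa using congrFun he (Sum.inr i)

/-- The homomorphism `F ↦ F(Ŷ)`, which sets each `Z_j` to `Ŷ_j = M₀(b̃^j)`, where `b̃^j` is the
`j`-th column of the principal matrix. -/
def evalYHat : ZField B d →+* Ambient B d Λ :=
  QSkewField.map (yHatMonomial B d Λ) (yHatMonomial_injective B d Λ)

/-- `F` expresses the cluster variable `X_{j;t}` as `F(Ŷ) M₀(g_{j;t})`. -/
def IsQuantumF (t : TreeVertex n) (j : Fin n) (F : ZField B d) : Prop :=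
  clusterVar B d Λ t j = evalYHat B d Λ F * frame0 B d Λ (gVectorExt B t (Sum.inl j))

/-- The (left) quantum `F`-polynomial `F_{j;t}`. -/
def quantumF (t : TreeVertex n) (j : Fin n) : ZField B d :=
  Classical.epsilon (IsQuantumF B d Λ t j)

/-- `q^(r/2) Z^b ↦ q^(r/2 - ∑ a_i b_i d_i) Z^b`. -/
def twistMonomial (a : Fin n → ℤ) : QMonomial (zForm B d) →* QMonomial (zForm B d) where
  toFun x := ⟨x.a - 2 * ∑ i, a i * x.e i * d i, x.e⟩
  map_one' := by ext1 <;> simp [QMonomial.one_a, QMonomial.one_e]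
  map_mul' x y := by
    ext1
    · simp only [QMonomial.mul_a, QMonomial.mul_e, Pi.add_apply, mul_add, add_mul,
        Finset.sum_add_distrib]
      ring
    · rfl

theorem twistMonomial_injective (a : Fin n → ℤ) : Function.Injective (twistMonomial B d a) := by
  intro x y h
  have he : x.e = y.e := (QMonomial.ext_iff.1 h).2
  have ha : x.a - 2 * ∑ i, a i * x.e i * d i = y.a - 2 * ∑ i, a i * y.e i * d i :=
    (QMonomial.ext_iff.1 h).1
  rw [he] at ha
  ext1
  · exact sub_left_injective ha
  · exact he

/-- The operator `L[a]`: the `ℤ[q^(±1/2)]`-linear map with `L[a](Z^b) = q^(-∑ a_i b_i d_i) Z^b` on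
the quantum torus, which is a ring automorphism, extended to the skew-field of fractions. -/
def twist (a : Fin n → ℤ) : ZField B d →+* ZField B d :=
  QSkewField.map (twistMonomial B d a) (twistMonomial_injective B d a)

/-! ### The recurrence -/

/-- The entry `b^t_{ik}` of the exchange matrix at `t`. -/
def exch (t : TreeVertex n) (i : Idx n) (k : Fin n) : ℤ := (quantumSeed B d Λ t.1).b i k

/-- `[ε b^t_{ik}]_+`. -/
def exchPos (ε : ℤ) (t : TreeVertex n) (k : Fin n) (i : Idx n) : ℤ :=
  plusPart (ε * exch B d Λ t i k)

/-- `G_j^{(ε)}`, the ordered product of `L[(i - 1) g_{j;t}](F_{j;t})` over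
`i = 1, …, [ε b^t_{jk}]_+`. -/
def recG (ε : ℤ) (t : TreeVertex n) (k j : Fin n) : ZField B d :=
  (List.ofFn fun i : Fin (exchPos B d Λ ε t k (Sum.inl j)).toNat =>
    twist B d ((i : ℤ) • gVector B t j) (quantumF B d Λ t j)).prod

/-- `F̂_{j;t}` to the power `{[ε b^t_{jk}]_+}`. -/
def recFHat (ε : ℤ) (t : TreeVertex n) (k j : Fin n) : ZField B d :=
  twist B d (-gVector B t k +
      ∑ i ∈ Finset.Iio j, exchPos B d Λ ε t k (Sum.inl i) • gVector B t i)
    (recG B d Λ ε t k j)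

/-- `F̂_{k;t}` to the power `{-1}`. -/
def recFHatInv (t : TreeVertex n) (k : Fin n) : ZField B d :=
  (twist B d (-gVector B t k) (quantumF B d Λ t k))⁻¹

/-- `2 ρ^ε`. -/
def twoRho (ε : ℤ) (t : TreeVertex n) (k : Fin n) : ℤ :=
  (-∑ i, exchPos B d Λ ε t k i * rho B d Λ t i (Sum.inl k))
    + (∑ i, ∑ j ∈ Finset.Ioi i, exchPos B d Λ ε t k (Sum.inl i) *
        exchPos B d Λ ε t k (Sum.inl j) * rho B d Λ t (Sum.inl j) (Sum.inl i))
    + ∑ i, ∑ j, exchPos B d Λ ε t k (Sum.inl i) *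
        exchPos B d Λ ε t k (Sum.inr j) * rho B d Λ t (Sum.inr j) (Sum.inl i)

/-- `2 λ^ε`; here `g_{k;t'}` enters. -/
def twoLambda (ε : ℤ) (t t' : TreeVertex n) (k : Fin n) : ℤ :=
  ∑ i, exchPos B d Λ ε t k (Sum.inr i) * gVector B t' k i * d i

/-- The summand with sign `ε` of the recurrence. -/
def recTerm (ε : ℤ) (t t' : TreeVertex n) (k : Fin n) : ZField B d :=
  QSkewField.qHalf (zForm B d) ^ (twoRho B d Λ ε t k - twoLambda B d Λ ε t t' k) *
    recFHatInv B d Λ t k *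
    (List.ofFn fun i : Fin n => recFHat B d Λ ε t k i).prod *
    zMon B d (fun l => exchPos B d Λ ε t k (Sum.inr l))

end Quantum

end QCA

end

/-! The recurrence is the quantum exchange relation rewritten in the initial toric frame. Across an
edge labelled k, `clusterVar_edge` gives X_{k;t'} = M_t(-e_k + ∑[b_ik]_+ e_i) + M_t(-e_k +
∑[-b_ik]_+ e_i). Up to a power of q, each term is an ordered product of X_{k;t}⁻¹, powers
X_{i;t}^{a_i} and a frozen monomial. Insert X_{i;t} = F_{i;t}(Ŷ) M₀(g_{i;t}) and move every M₀ to
the right: by compatibility of Λ₀ with B̃⁰, passing M₀(g) over F(Ŷ) applies L[g] to F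
(`frame0_mul_evalYHat`). This produces G_j and F̂_j.

The power of q comes from splitting M_t with its own form and merging the M₀ factors with Λ₀. The
two forms differ by ρ^t, and adding the contributions over the ordered product gives ρ^ε
(`frame_prefixVec`, `rhoForm_sum_eq`). The remaining M₀ has exponent B̃⁰a + g_{k;t'}, where a is the
frozen part (`gExtMap_eq_add`, `gVector_edge`); splitting it yields the Z-monomial and λ^ε. The
g-vector step is valid for both signs ε because the degree map kills the columns of the exchange
matrix, so sign-coherence plays no role.

Two supporting facts are needed. Every quantum seed is a toric frame with a compatible matrix
(`IsToricFrame.mutate`, `IsCompatible.mutate`), where the q-Pascal identity converts the binomial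
sum defining M' into powers of the new variable. Every cluster variable has a unique degree
(`IsDegreeMap.cons`, `HasDegree.unique`). Existence of F follows by induction along reduced words,
the recurrence supplying the witness; uniqueness holds because F ↦ F(Ŷ) is injective and M₀(g) is
invertible. -/

noncomputable section

namespace QCA

/-! ### Monomials in the skew-field of fractions -/

namespace QSkewField

variable {ι κ : Type} [Fintype ι] [Fintype κ] {Λ : Matrix ι ι ℤ} {Λ' : Matrix κ κ ℤ}

/-- The image of a monomial in the skew-field of fractions. -/
def mono (Λ : Matrix ι ι ℤ) : QMonomial Λ →* QSkewField Λ :=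
  (incl Λ : QTorus Λ →* QSkewField Λ).comp (MonoidAlgebra.of ℤ (QMonomial Λ))

theorem mono_apply (m : QMonomial Λ) : mono Λ m = incl Λ (MonoidAlgebra.single m 1) := rfl

theorem mono_injective : Function.Injective (mono Λ) :=
  (incl_injective Λ).comp MonoidAlgebra.of_injective

theorem exists_incl_mul_eq (x : QSkewField Λ) :
    ∃ s r : QTorus Λ, incl Λ s ≠ 0 ∧ incl Λ s * x = incl Λ r := by
  induction x using OreLocalization.ind with
  | _ r s =>
    refine ⟨s, r, ?_, ?_⟩
    · intro h
      exact nonZeroDivisors.coe_ne_zero s (incl_injective Λ (h.trans (map_zero _).symm))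
    · change ((s : QTorus Λ) /ₒ 1) * (r /ₒ s) = r /ₒ 1
      exact OreLocalization.mul_cancel

/-- Monomials span the group ring over ℤ, and every element of the skew-field is a left fraction, so
denominators can be cleared. Commutation rules thus reduce to comparing a conjugation with another
homomorphism on monomials. -/
theorem hom_ext {K : Type} [DivisionRing K] {f g : QSkewField Λ →+* K}
    (h : ∀ m, f (mono Λ m) = g (mono Λ m)) : f = g := by
  have h1 : f.comp (incl Λ) = g.comp (incl Λ) := by
    refine MonoidAlgebra.ringHom_ext (fun a => ?_) (fun m => h m)
    exact congrArg (fun φ : ℤ →+* K => φ a) (Subsingleton.elim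
      ((f.comp (incl Λ)).comp MonoidAlgebra.singleOneRingHom)
      ((g.comp (incl Λ)).comp MonoidAlgebra.singleOneRingHom))
  ext x
  obtain ⟨s, r, hs, hx⟩ := exists_incl_mul_eq x
  have h2 : f (incl Λ s) ≠ 0 := (map_ne_zero f).2 hs
  refine mul_left_cancel₀ h2 ?_
  rw [← map_mul, hx]
  have e1 := RingHom.congr_fun h1 s
  have e2 := RingHom.congr_fun h1 r
  simp only [RingHom.comp_apply] at e1 e2
  rw [e1, e2, ← map_mul, hx]

theorem map_mono (f : QMonomial Λ →* QMonomial Λ') (hf : Function.Injective f)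
    (m : QMonomial Λ) : map f hf (mono Λ m) = mono Λ' (f m) := by
  refine (OreLocalization.universalHom_commutes _ _ _).trans ?_
  simp [mono_apply]

theorem qHalf_eq_mono : qHalf Λ = mono Λ ⟨1, 0⟩ := rfl

theorem X_eq_mono (e : ι → ℤ) : X Λ e = mono Λ ⟨0, e⟩ := rfl

theorem mono_ne_zero (m : QMonomial Λ) : mono Λ m ≠ 0 := by
  intro h
  have := map_mul (mono Λ) m m⁻¹
  rw [h, zero_mul, mul_inv_cancel, map_one] at this
  exact one_ne_zero this

theorem qHalf_ne_zero : qHalf Λ ≠ 0 := mono_ne_zero _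

theorem qHalf_pow (r : ℕ) : qHalf Λ ^ r = mono Λ ⟨r, 0⟩ := by
  induction r with
  | zero => exact (pow_zero _).trans (map_one (mono Λ)).symm
  | succ r ih =>
    rw [pow_succ, ih, qHalf_eq_mono, ← map_mul]
    congr 1
    ext1
    · simp [QMonomial.mul_a]
    · simp [QMonomial.mul_e]

theorem qHalf_zpow (r : ℤ) : qHalf Λ ^ r = mono Λ ⟨r, 0⟩ := by
  obtain ⟨m, rfl | rfl⟩ := r.eq_nat_or_neg
  · rw [zpow_natCast, qHalf_pow]
  · rw [zpow_neg, zpow_natCast, qHalf_pow]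
    refine inv_eq_of_mul_eq_one_right ?_
    rw [← map_mul, ← map_one (mono Λ)]
    congr 1
    ext1
    · simp [QMonomial.mul_a, QMonomial.one_a]
    · simp [QMonomial.mul_e, QMonomial.one_e]

theorem eq_zero_of_qHalf_zpow_eq_one {r : ℤ} (h : qHalf Λ ^ r = 1) : r = 0 := by
  rw [qHalf_zpow, ← map_one (mono Λ)] at h
  exact congrArg QMonomial.a (mono_injective h)

theorem mono_eq (m : QMonomial Λ) : mono Λ m = qHalf Λ ^ m.a * X Λ m.e := by
  rw [qHalf_zpow, X_eq_mono, ← map_mul]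
  congr 1
  ext1
  · simp [QMonomial.mul_a]
  · simp [QMonomial.mul_e]

theorem X_mul_X (e f : ι → ℤ) : X Λ e * X Λ f = qHalf Λ ^ (e ⬝ᵥ Λ *ᵥ f) * X Λ (e + f) := by
  rw [X_eq_mono, X_eq_mono, ← map_mul, mono_eq]
  simp [QMonomial.mul_a, QMonomial.mul_e]

/-- Conjugation by a nonzero element. -/
def conj {K : Type} [DivisionRing K] (a : K) (ha : a ≠ 0) : K →+* K where
  toFun x := a * x * a⁻¹
  map_one' := by simp [ha]
  map_mul' x y := by simp [mul_assoc, ha]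
  map_zero' := by simp
  map_add' x y := by simp [mul_add, add_mul]

/-- `q^(1/2)` is central. -/
theorem qHalf_comm (x : QSkewField Λ) : qHalf Λ * x = x * qHalf Λ := by
  have h : conj (qHalf Λ) qHalf_ne_zero = RingHom.id _ := by
    refine hom_ext fun m => ?_
    change qHalf Λ * mono Λ m * (qHalf Λ)⁻¹ = mono Λ m
    rw [mul_inv_eq_iff_eq_mul₀ qHalf_ne_zero, qHalf_eq_mono, ← map_mul, ← map_mul]
    congr 1
    ext1
    · simp only [QMonomial.mul_a]; simp [add_comm]
    · simp [QMonomial.mul_e]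
  have := RingHom.congr_fun h x
  change qHalf Λ * x * (qHalf Λ)⁻¹ = x at this
  rwa [mul_inv_eq_iff_eq_mul₀ qHalf_ne_zero] at this

end QSkewField

/-! ### Mutation of exchange matrices and the linear map E -/

section MatrixMutation

variable {n : ℕ} {k : Fin n} {b : Matrix (Idx n) (Fin n) ℤ}

/-- The `k`-th column of an exchange matrix. -/
def column (b : Matrix (Idx n) (Fin n) ℤ) (k : Fin n) : Idx n → ℤ := fun i => b i k

/-- The basis vector `e_i`. -/
abbrev basisVec (i : Idx n) : Idx n → ℤ := Pi.single i 1

theorem plusPart_sub_plusPart_neg (x : ℤ) : plusPart x - plusPart (-x) = x := by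
  unfold plusPart; omega

theorem plusPart_mul_of_nonneg {x : ℤ} (hx : 0 ≤ x) (y : ℤ) :
    plusPart (x * y) = x * plusPart y := by
  unfold plusPart
  rw [mul_max_of_nonneg _ _ hx, mul_zero]

theorem mutE_mulVec_apply (k : Fin n) (b : Matrix (Idx n) (Fin n) ℤ) (c : Idx n → ℤ) (i : Idx n) :
    (mutE k b *ᵥ c) i =
      if i = Sum.inl k then -c (Sum.inl k) else c i + plusPart (-b i k) * c (Sum.inl k) := by
  have h : ∀ j, mutE k b i j * c j = (if i = j then (if i = Sum.inl k then 0 else c i) else 0) +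
      (if Sum.inl k = j then
        (if i = Sum.inl k then -1 else plusPart (-b i k)) * c (Sum.inl k) else 0) := by
    intro j
    simp only [mutE, Matrix.of_apply, plusPart, max_comm]
    by_cases hj : j = Sum.inl k
    · subst hj
      by_cases hi : i = Sum.inl k <;> simp [hi]
    · by_cases hij : i = j
      · subst hij; simp [hj, Ne.symm hj]
      · simp [hj, hij, Ne.symm hj]
  simp only [Matrix.mulVec, dotProduct, h, Finset.sum_add_distrib, Finset.sum_ite_eq,
    Finset.mem_univ, if_true]
  split_ifs <;> simp

theorem mutE_mulVec_of_eq_zero {c : Idx n → ℤ} (hc : c (Sum.inl k) = 0) :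
    mutE k b *ᵥ c = c := by
  ext i
  rw [mutE_mulVec_apply, hc]
  split_ifs with h
  · rw [h, hc, neg_zero]
  · simp

/-- The vector `∑_i [ε b_ik]_+ e_i`. -/
def posColumn (ε : ℤ) (b : Matrix (Idx n) (Fin n) ℤ) (k : Fin n) : Idx n → ℤ :=
  fun i => plusPart (ε * b i k)

theorem posColumn_self (ε : ℤ) (hb : b (Sum.inl k) k = 0) :
    posColumn ε b k (Sum.inl k) = 0 := by
  simp [posColumn, hb, plusPart]

/-- This is [x]_+ - [-x]_+ = x in each coordinate; the exponents of the two exchange monomials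
therefore differ by the column b^k. -/
theorem posColumn_one : posColumn 1 b k = posColumn (-1) b k + column b k := by
  ext i
  have := plusPart_sub_plusPart_neg (b i k)
  simp only [posColumn, column, Pi.add_apply, one_mul, neg_mul]
  omega

theorem mutE_mulVec_basisVec (hb : b (Sum.inl k) k = 0) :
    mutE k b *ᵥ basisVec (Sum.inl k) = -basisVec (Sum.inl k) + posColumn (-1) b k := by
  ext i
  rw [mutE_mulVec_apply]
  by_cases hi : i = Sum.inl k
  · subst hi
    simp [posColumn_self _ hb]
  · simp [hi, posColumn]

theorem mutMatrix_apply_self (i : Idx n) : mutMatrix k b i k = -b i k := by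
  simp [mutMatrix]

theorem mutMatrix_apply_row (j : Fin n) : mutMatrix k b (Sum.inl k) j = -b (Sum.inl k) j := by
  simp [mutMatrix]

theorem posColumn_mutMatrix (ε : ℤ) : posColumn ε (mutMatrix k b) k = posColumn (-ε) b k := by
  ext i
  simp [posColumn, mutMatrix_apply_self]

theorem mutE_mulVec_column_self (hb : b (Sum.inl k) k = 0) :
    mutE k b *ᵥ column (mutMatrix k b) k = -column b k := by
  rw [mutE_mulVec_of_eq_zero]
  · ext i; simp [column, mutMatrix_apply_self]
  · simp [column, mutMatrix_apply_self, hb]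

/-- E carries mutated columns into the span of the old ones. Both compatibility and the vanishing of
degrees on columns propagate through this identity. -/
theorem mutE_mulVec_column {j : Fin n} (hj : j ≠ k) (hb : b (Sum.inl k) k = 0) :
    mutE k b *ᵥ column (mutMatrix k b) j =
      column b j + plusPart (b (Sum.inl k) j) • column b k := by
  ext i
  rw [mutE_mulVec_apply]
  simp only [column, Pi.add_apply, Pi.smul_apply, smul_eq_mul, mutMatrix_apply_row]
  by_cases hi : i = Sum.inl k
  · subst hi; simp [hb]
  · simp only [hi, if_false, mutMatrix, Matrix.of_apply, hj, or_self]
    have h1 := plusPart_sub_plusPart_neg (b i k)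
    -- Fixing the sign of b_kj allows it to be pulled out of [b_ik b_kj]_+.
    rcases le_total 0 (b (Sum.inl k) j) with h | h
    · rw [mul_comm (b i k), plusPart_mul_of_nonneg h]
      have h2 : plusPart (b (Sum.inl k) j) = b (Sum.inl k) j := max_eq_left h
      have h3 : (b i k).sign * plusPart (b i k) = plusPart (b i k) := by
        rcases lt_trichotomy (b i k) 0 with h4 | h4 | h4
        · rw [plusPart, max_eq_right h4.le, mul_zero]
        · rw [h4]; simp [plusPart]
        · rw [Int.sign_eq_one_of_pos h4, one_mul]
      rw [h2, mul_left_comm, h3]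
      linear_combination b (Sum.inl k) j * h1
    · have h0 : b i k * b (Sum.inl k) j = -b (Sum.inl k) j * -b i k := by ring
      rw [h0, plusPart_mul_of_nonneg (by omega)]
      have h2 : plusPart (b (Sum.inl k) j) = 0 := max_eq_right h
      have h3 : (b i k).sign * plusPart (-b i k) = -plusPart (-b i k) := by
        rcases lt_trichotomy (b i k) 0 with h4 | h4 | h4
        · rw [Int.sign_eq_neg_one_of_neg h4]; ring
        · rw [h4]; simp [plusPart]
        · rw [plusPart, max_eq_right (by omega)]; simp
      rw [h2, mul_left_comm, h3]
      ring

end MatrixMutation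

/-! ### Quantum binomial coefficients -/

section Binomial

/-- A central unit of infinite order of a division ring. -/
structure IsQuantumParam {K : Type} [DivisionRing K] (q : K) : Prop where
  ne_zero : q ≠ 0
  comm : ∀ x, q * x = x * q
  zpow_eq_one : ∀ {m : ℤ}, q ^ m = 1 → m = 0

namespace IsQuantumParam

variable {K : Type} [DivisionRing K] {q : K} (hq : IsQuantumParam q)
include hq

theorem zpow_comm (m : ℤ) (x : K) : q ^ m * x = x * q ^ m :=
  (Commute.zpow_left₀ (show Commute q x from hq.comm x) m).eq

theorem mul_zpow_mul (m : ℤ) (x y : K) : x * (q ^ m * y) = q ^ m * (x * y) := by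
  rw [← mul_assoc, ← hq.zpow_comm, mul_assoc]

theorem zpow_mul_zpow_mul (m l : ℤ) (x : K) : q ^ m * (q ^ l * x) = q ^ (m + l) * x := by
  rw [← mul_assoc, zpow_add₀ hq.ne_zero]

theorem zpow_inj {m l : ℤ} (h : q ^ m = q ^ l) : m = l := by
  have : q ^ (m - l) = 1 := by
    rw [zpow_sub₀ hq.ne_zero, h, div_self (zpow_ne_zero _ hq.ne_zero)]
  have := hq.zpow_eq_one this
  omega

end IsQuantumParam

theorem tBinom_zero_right {K : Type} [DivisionRing K] (t : K) (r : ℕ) : tBinom t r 0 = 1 := by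
  simp [tBinom]

theorem tBinom_succ_right {K : Type} [DivisionRing K] (t : K) (r p : ℕ) :
    tBinom t r (p + 1) = tBinom t r p *
      ((t ^ ((r : ℤ) - p) - t ^ (-((r : ℤ) - p))) / (t ^ ((p : ℤ) + 1) - t ^ (-((p : ℤ) + 1)))) := by
  simp [tBinom, List.range_succ]

/-- The factor with index r has numerator t^0 - t^0. -/
theorem tBinom_eq_zero {K : Type} [DivisionRing K] (t : K) {r p : ℕ} (h : r < p) :
    tBinom t r p = 0 := by
  induction p with
  | zero => omega
  | succ p ih =>
    rw [tBinom_succ_right]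
    rcases Nat.lt_succ_iff_lt_or_eq.1 h with h | h
    · rw [ih h, zero_mul]
    · subst h; simp

/-- The absorption identity: it expresses both sides of Pascal's rule through the same coefficient.
-/
theorem tBinom_succ_succ {K : Type} [Field K] {t : K}
    (ht : ∀ p : ℕ, t ^ ((p : ℤ) + 1) - t ^ (-((p : ℤ) + 1)) ≠ 0) (r p : ℕ) :
    tBinom t (r + 1) (p + 1) = (t ^ ((r : ℤ) + 1) - t ^ (-((r : ℤ) + 1))) /
      (t ^ ((p : ℤ) + 1) - t ^ (-((p : ℤ) + 1))) * tBinom t r p := by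
  induction p with
  | zero => rw [tBinom_succ_right, tBinom_zero_right, tBinom_zero_right]; simp
  | succ p ih =>
    rw [tBinom_succ_right, ih, tBinom_succ_right _ r p]
    have h1 : (((r + 1 : ℕ) : ℤ) - (p + 1 : ℕ)) = r - p := by push_cast; ring
    rw [h1]
    have h2 := ht p
    have h3 := ht (p + 1)
    field_simp

theorem tBinom_pascal_field {K : Type} [Field K] {t : K} (h0 : t ≠ 0)
    (ht : ∀ p : ℕ, t ^ ((p : ℤ) + 1) - t ^ (-((p : ℤ) + 1)) ≠ 0) (r p : ℕ) :
    tBinom t (r + 1) (p + 1) =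
      t ^ (-((p : ℤ) + 1)) * tBinom t r (p + 1) + t ^ ((r : ℤ) - p) * tBinom t r p := by
  rw [tBinom_succ_succ ht, tBinom_succ_right]
  have h2 := ht p
  -- With [m] = t^m - t^(-m), this is [r+1] = t^(-(p+1)) [r-p] + t^(r-p) [p+1], which is Pascal's
  -- rule after clearing denominators.
  have h3 : t ^ ((r : ℤ) + 1) - t ^ (-((r : ℤ) + 1)) =
      t ^ (-((p : ℤ) + 1)) * (t ^ ((r : ℤ) - p) - t ^ (-((r : ℤ) - p))) +
        t ^ ((r : ℤ) - p) * (t ^ ((p : ℤ) + 1) - t ^ (-((p : ℤ) + 1))) := by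
    simp only [mul_sub, ← zpow_add₀ h0]
    ring_nf
  rw [h3]
  field_simp

theorem coe_tBinom {K : Type} [DivisionRing K] (t : Subring.center K) (r p : ℕ) :
    ((tBinom t r p : Subring.center K) : K) = tBinom (t : K) r p := by
  have h (m : ℤ) : ((t ^ m : Subring.center K) : K) = (t : K) ^ m :=
    map_zpow₀ (Subring.center K).subtype t m
  induction p with
  | zero => simp [tBinom_zero_right]
  | succ p ih => simp only [tBinom_succ_right, Subring.coe_mul, Subring.center.coe_div,
      AddSubgroupClass.coe_sub, ih, h]

theorem IsQuantumParam.zpow_mem_center {K : Type} [DivisionRing K] {q : K}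
    (hq : IsQuantumParam q) (m : ℤ) : q ^ m ∈ Subring.center K :=
  Subring.mem_center_iff.2 fun x => (hq.zpow_comm m x).symm

theorem IsQuantumParam.zpow_sub_zpow_ne_zero {K : Type} [DivisionRing K] {q : K}
    (hq : IsQuantumParam q) {m : ℤ} (hm : 0 < m) (p : ℕ) :
    (q ^ m) ^ ((p : ℤ) + 1) - (q ^ m) ^ (-((p : ℤ) + 1)) ≠ 0 := by
  intro h
  rw [sub_eq_zero, ← zpow_mul, ← zpow_mul] at h
  have := hq.zpow_inj h
  nlinarith

/-- All quantities are rational in the central element q^m, so the identity is proved in the centre,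
which is a field, and mapped to K. -/
theorem IsQuantumParam.tBinom_pascal {K : Type} [DivisionRing K] {q : K}
    (hq : IsQuantumParam q) {m : ℤ} (hm : 0 < m) (r p : ℕ) :
    tBinom (q ^ m) (r + 1) (p + 1) =
      q ^ (-(m * ((p : ℤ) + 1))) * tBinom (q ^ m) r (p + 1) +
        q ^ (m * ((r : ℤ) - p)) * tBinom (q ^ m) r p := by
  let t : Subring.center K := ⟨q ^ m, hq.zpow_mem_center m⟩
  have hc (l : ℤ) : ((t ^ l : Subring.center K) : K) = q ^ (m * l) := by
    rw [zpow_mul]; exact map_zpow₀ (Subring.center K).subtype t l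
  have h := tBinom_pascal_field (t := t)
    (fun h => zpow_ne_zero m hq.ne_zero (congrArg Subtype.val h))
    (fun p h => hq.zpow_sub_zpow_ne_zero hm p (by
      rw [← zpow_mul, ← zpow_mul, ← hc, ← hc]; exact congrArg Subtype.val h)) r p
  have h' := congrArg Subtype.val h
  simp only [Subring.coe_add, Subring.coe_mul, coe_tBinom, hc, mul_neg] at h'
  exact h'

theorem IsQuantumParam.tBinom_one_one {K : Type} [DivisionRing K] {q : K}
    (hq : IsQuantumParam q) {m : ℤ} (hm : 0 < m) : tBinom (q ^ m) 1 1 = 1 := by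
  rw [tBinom_succ_right, tBinom_zero_right]
  simpa using div_self (hq.zpow_sub_zpow_ne_zero hm 0)

end Binomial

/-! ### Toric frames, compatibility and the q-Pascal step -/

section Frames

variable {n : ℕ} {K : Type} [DivisionRing K]

/-- `M` is a toric frame whose quasi-commutation form is `Ω`. -/
structure IsToricFrame (q : K) (M : (Idx n → ℤ) → K)
    (Ω : (Idx n → ℤ) →ₗ[ℤ] (Idx n → ℤ) →ₗ[ℤ] ℤ) : Prop where
  ne_zero : ∀ c, M c ≠ 0
  mul : ∀ c c', M c * M c' = q ^ Ω c c' * M (c + c')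
  skew : ∀ c c', Ω c c' = -Ω c' c

/-- The exchange matrix `b` is compatible with the form `Ω`. -/
def IsCompatible (d : Fin n → ℤ) (b : Matrix (Idx n) (Fin n) ℤ)
    (Ω : (Idx n → ℤ) →ₗ[ℤ] (Idx n → ℤ) →ₗ[ℤ] ℤ) : Prop :=
  ∀ k c, Ω (column b k) c = d k * c (Sum.inl k)

/-- The sum defining the mutated toric frame at `c` if `c_k ≥ 0`. -/
def frameMutatePos (q : K) (d : Fin n → ℤ) (k : Fin n) (M : (Idx n → ℤ) → K)
    (b : Matrix (Idx n) (Fin n) ℤ) (c : Idx n → ℤ) : K :=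
  ∑ p ∈ Finset.range ((c (Sum.inl k)).toNat + 1),
    tBinom (q ^ d k) (c (Sum.inl k)).toNat p * M (mutE k b *ᵥ c + (p : ℤ) • fun i => b i k)

/-- The mutated toric frame. -/
def frameMutate (q : K) (d : Fin n → ℤ) (k : Fin n) (M : (Idx n → ℤ) → K)
    (b : Matrix (Idx n) (Fin n) ℤ) (c : Idx n → ℤ) : K :=
  if 0 ≤ c (Sum.inl k) then frameMutatePos q d k M b c else (frameMutatePos q d k M b (-c))⁻¹

/-- The quasi-commutation form of the mutated toric frame. -/
def formMutate (k : Fin n) (b : Matrix (Idx n) (Fin n) ℤ)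
    (Ω : (Idx n → ℤ) →ₗ[ℤ] (Idx n → ℤ) →ₗ[ℤ] ℤ) : (Idx n → ℤ) →ₗ[ℤ] (Idx n → ℤ) →ₗ[ℤ] ℤ :=
  Ω.compl₁₂ (mutE k b).mulVecLin (mutE k b).mulVecLin

variable {q : K} {d : Fin n → ℤ} {k : Fin n} {M : (Idx n → ℤ) → K}
  {b : Matrix (Idx n) (Fin n) ℤ} {Ω : (Idx n → ℤ) →ₗ[ℤ] (Idx n → ℤ) →ₗ[ℤ] ℤ}

theorem formMutate_apply (c c' : Idx n → ℤ) :
    formMutate k b Ω c c' = Ω (mutE k b *ᵥ c) (mutE k b *ᵥ c') := rfl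

namespace IsToricFrame

theorem form_self (h : IsToricFrame q M Ω) (c : Idx n → ℤ) : Ω c c = 0 := by
  have := h.skew c c; omega

theorem map_zero (h : IsToricFrame q M Ω) : M 0 = 1 := by
  have := h.mul 0 0
  simp only [_root_.map_zero, zpow_zero, one_mul, add_zero] at this
  exact mul_left_cancel₀ (h.ne_zero 0) (by rw [this, mul_one])

theorem map_neg (h : IsToricFrame q M Ω) (c : Idx n → ℤ) : M (-c) = (M c)⁻¹ := by
  refine eq_inv_of_mul_eq_one_left ?_
  rw [h.mul, neg_add_cancel, h.map_zero, _root_.map_neg, LinearMap.neg_apply, h.form_self]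
  simp

theorem map_add (hq : IsQuantumParam q) (h : IsToricFrame q M Ω) (c c' : Idx n → ℤ) :
    M (c + c') = q ^ (-Ω c c') * (M c * M c') := by
  rw [h.mul, hq.zpow_mul_zpow_mul, neg_add_cancel, zpow_zero, one_mul]

theorem quasi_comm (hq : IsQuantumParam q) (h : IsToricFrame q M Ω) (c c' : Idx n → ℤ) :
    M c * M c' = q ^ (2 * Ω c c') * (M c' * M c) := by
  rw [h.mul, h.mul, hq.zpow_mul_zpow_mul, h.skew c' c, add_comm c']
  congr 2; ring

theorem map_nsmul (h : IsToricFrame q M Ω) (c : Idx n → ℤ) (r : ℕ) :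
    M ((r : ℤ) • c) = M c ^ r := by
  induction r with
  | zero => simp [h.map_zero]
  | succ r ih =>
    rw [pow_succ, ← ih, h.mul, map_smul, LinearMap.smul_apply, h.form_self, smul_zero, zpow_zero,
      one_mul]
    congr 1; push_cast; module

end IsToricFrame

/-- Both sides evaluate Ω(b^i, b^j). Skew-symmetrizability is thus a consequence of compatibility
and need not be carried through mutations separately. -/
theorem IsCompatible.skew (h : IsToricFrame q M Ω) (hc : IsCompatible d b Ω) (i j : Fin n) :
    d i * b (Sum.inl i) j = -(d j * b (Sum.inl j) i) := by
  have h1 := hc i (column b j)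
  have h2 := hc j (column b i)
  rw [h.skew, h2] at h1
  exact h1.symm

theorem IsCompatible.diag (hd : ∀ i, 0 < d i) (h : IsToricFrame q M Ω)
    (hc : IsCompatible d b Ω) (k : Fin n) : b (Sum.inl k) k = 0 := by
  have h1 := hc.skew h k k
  have h2 : d k * b (Sum.inl k) k = 0 := by omega
  exact (mul_eq_zero.1 h2).resolve_left (hd k).ne'

theorem IsCompatible.mutate (hd : ∀ i, 0 < d i) (h : IsToricFrame q M Ω)
    (hc : IsCompatible d b Ω) (k : Fin n) :
    IsCompatible d (mutMatrix k b) (formMutate k b Ω) := by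
  intro j c
  have hb := hc.diag hd h k
  rw [formMutate_apply]
  by_cases hj : j = k
  · subst hj
    rw [mutE_mulVec_column_self hb, map_neg, LinearMap.neg_apply, hc, mutE_mulVec_apply]
    simp
  · rw [mutE_mulVec_column hj hb, map_add, map_smul, LinearMap.add_apply, LinearMap.smul_apply,
      hc, hc, mutE_mulVec_apply, mutE_mulVec_apply]
    have hjk : (Sum.inl j : Idx n) ≠ Sum.inl k := fun h => hj (Sum.inl_injective h)
    -- The correction from E at coordinate j must cancel the one from the added multiple of b^k;
    -- skew-symmetrizability makes them equal.
    have h1 : d j * plusPart (-b (Sum.inl j) k) = d k * plusPart (b (Sum.inl k) j) := by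
      rw [← plusPart_mul_of_nonneg (hd j).le, ← plusPart_mul_of_nonneg (hd k).le,
        hc.skew h k j, mul_neg]
    simp only [hjk, if_true, if_false, smul_eq_mul]
    linear_combination c (Sum.inl k) * h1

section Mutation

variable (hq : IsQuantumParam q) (hd : ∀ i, 0 < d i) (h : IsToricFrame q M Ω)
  (hc : IsCompatible d b Ω)
include hq hd h hc

omit hq hd h hc in
theorem frameMutatePos_of_eq_zero {c : Idx n → ℤ} (hck : c (Sum.inl k) = 0) :
    frameMutatePos q d k M b c = M c := by
  simp [frameMutatePos, hck, tBinom_zero_right, mutE_mulVec_of_eq_zero]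

omit hq hd h hc in
theorem frameMutate_of_eq_zero {c : Idx n → ℤ} (hck : c (Sum.inl k) = 0) :
    frameMutate q d k M b c = M c := by
  rw [frameMutate, if_pos hck.ge, frameMutatePos_of_eq_zero hck]

/-- The exchange relation: for c_k = 1 only p = 0, 1 occur, both with coefficient 1. -/
theorem frameMutatePos_basisVec : frameMutatePos q d k M b (basisVec (Sum.inl k)) =
    M (-basisVec (Sum.inl k) + posColumn 1 b k) +
      M (-basisVec (Sum.inl k) + posColumn (-1) b k) := by
  have hb := hc.diag hd h k
  have e1 : (basisVec (Sum.inl k) : Idx n → ℤ) (Sum.inl k) = 1 := by simp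
  rw [frameMutatePos, mutE_mulVec_basisVec hb, e1, posColumn_one]
  simp [Finset.sum_range_succ, tBinom_zero_right, hq.tBinom_one_one (hd k), add_assoc, add_comm]
  rfl

theorem frameMutate_basisVec : frameMutate q d k M b (basisVec (Sum.inl k)) =
    M (-basisVec (Sum.inl k) + posColumn 1 b k) +
      M (-basisVec (Sum.inl k) + posColumn (-1) b k) := by
  rw [frameMutate, if_pos (by simp), frameMutatePos_basisVec hq hd h hc]

/-- If the two exchange monomials cancelled, M(b^k) would be minus a power of q, hence central; but
it quasi-commutes with M(e_k) with the nonzero exponent 2d_k. -/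
theorem frameMutatePos_basisVec_ne_zero :
    frameMutatePos q d k M b (basisVec (Sum.inl k)) ≠ 0 := by
  rw [frameMutatePos_basisVec hq hd h hc, posColumn_one, ← add_assoc,
    h.map_add hq _ (column b k)]
  intro h0
  generalize -basisVec (Sum.inl k) + posColumn (-1) b k = v at h0
  generalize -Ω v (column b k) = m at h0
  have h1 : M (column b k) = -q ^ (-m) := by
    refine mul_left_cancel₀ (h.ne_zero v) (mul_left_cancel₀ (zpow_ne_zero m hq.ne_zero) ?_)
    rw [eq_neg_of_add_eq_zero_left h0, mul_neg, mul_neg, ← hq.zpow_comm, hq.zpow_mul_zpow_mul,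
      add_neg_cancel, zpow_zero, one_mul]
  have h2 := h.quasi_comm hq (column b k) (basisVec (Sum.inl k))
  rw [h1, hc, neg_mul, hq.zpow_comm, ← mul_neg] at h2
  have h3 := mul_right_cancel₀ (mul_ne_zero (h.ne_zero _)
    (neg_ne_zero.2 (zpow_ne_zero _ hq.ne_zero))) ((one_mul _).trans h2)
  have h4 := hq.zpow_eq_one h3.symm
  have h5 := hd k
  simp at h4
  omega

/-- Multiplying the sum by M(v) + M(v + b^k), with v = E e_k, makes M(u + v + (p+1)b^k), with u = E
c, occur twice. Compatibility determines the two powers of q, and they are those of the q-Pascal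
rule. -/
theorem frameMutatePos_mul_basisVec {c : Idx n → ℤ} (hck : 0 ≤ c (Sum.inl k)) :
    frameMutatePos q d k M b c * frameMutatePos q d k M b (basisVec (Sum.inl k)) =
      q ^ formMutate k b Ω c (basisVec (Sum.inl k)) *
        frameMutatePos q d k M b (c + basisVec (Sum.inl k)) := by
  obtain ⟨r, hr⟩ := Int.eq_ofNat_of_zero_le hck
  have hb := hc.diag hd h k
  rw [frameMutatePos_basisVec hq hd h hc, posColumn_one, ← add_assoc, ← mutE_mulVec_basisVec hb]
  have hr1 : ((c + basisVec (Sum.inl k)) (Sum.inl k)).toNat = r + 1 := by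
    simp [hr]
  unfold frameMutatePos
  rw [hr1, hr, Int.toNat_natCast, Matrix.mulVec_add]
  change (∑ p ∈ Finset.range (r + 1), tBinom (q ^ d k) r p *
    M (mutE k b *ᵥ c + (p : ℤ) • column b k)) * _ =
      _ * ∑ p ∈ Finset.range (r + 1 + 1), tBinom (q ^ d k) (r + 1) p *
    M (mutE k b *ᵥ c + mutE k b *ᵥ basisVec (Sum.inl k) + (p : ℤ) • column b k)
  rw [formMutate_apply]
  have hE : (mutE k b *ᵥ c) (Sum.inl k) = -r := by rw [mutE_mulVec_apply]; simp [hr]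
  have hE' : (mutE k b *ᵥ basisVec (Sum.inl k)) (Sum.inl k) = -1 := by
    rw [mutE_mulVec_apply]; simp
  -- From here on, only the k-th coordinates of u and v enter the pairings with b^k.
  generalize mutE k b *ᵥ c = u at *
  generalize mutE k b *ᵥ basisVec (Sum.inl k) = v at *
  have hub : Ω u (column b k) = d k * r := by rw [h.skew, hc, hE]; ring
  have hvb : Ω (column b k) v = -d k := by rw [hc, hE']; ring
  have t1 (p : ℕ) : M (u + (p : ℤ) • column b k) * M v =
      q ^ Ω u v * (q ^ (-(d k * p)) * M (u + v + (p : ℤ) • column b k)) := by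
    rw [h.mul, hq.zpow_mul_zpow_mul, map_add, map_smul, LinearMap.add_apply, LinearMap.smul_apply,
      hvb, add_right_comm]
    congr 2
    simp; ring
  have t2 (p : ℕ) : M (u + (p : ℤ) • column b k) * M (v + column b k) =
      q ^ Ω u v * (q ^ (d k * ((r : ℤ) - p)) *
        M (u + v + ((p + 1 : ℕ) : ℤ) • column b k)) := by
    rw [h.mul, hq.zpow_mul_zpow_mul]
    congr 2
    · simp only [map_add, map_smul, LinearMap.add_apply, LinearMap.smul_apply, hvb, hub,
        h.form_self, smul_eq_mul]
      ring
    · push_cast; module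
  have hpas : ∀ p, tBinom (q ^ d k) (r + 1) (p + 1) * M (u + v + ((p + 1 : ℕ) : ℤ) • column b k) =
      q ^ (-(d k * ((p : ℤ) + 1))) * (tBinom (q ^ d k) r (p + 1) *
        M (u + v + ((p + 1 : ℕ) : ℤ) • column b k)) +
      q ^ (d k * ((r : ℤ) - p)) * (tBinom (q ^ d k) r p *
        M (u + v + ((p + 1 : ℕ) : ℤ) • column b k)) := by
    intro p
    rw [hq.tBinom_pascal (hd k), add_mul, mul_assoc, mul_assoc]
  have t3 (p : ℕ) : tBinom (q ^ d k) r p * M (u + (p : ℤ) • column b k) *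
      (M (v + column b k) + M v) = q ^ Ω u v *
        (q ^ (-(d k * p)) * (tBinom (q ^ d k) r p * M (u + v + (p : ℤ) • column b k)) +
        q ^ (d k * ((r : ℤ) - p)) * (tBinom (q ^ d k) r p *
          M (u + v + ((p + 1 : ℕ) : ℤ) • column b k))) := by
    rw [mul_assoc, mul_add, t1, t2, ← mul_add, hq.mul_zpow_mul, mul_add, hq.mul_zpow_mul,
      hq.mul_zpow_mul, add_comm]
  -- The range is extended by p = r + 1, where the binomial vanishes, so that this sum, with its p =
  -- 0 term split off, aligns with the Pascal expansion.
  have hlast := Finset.sum_range_succ' (fun p : ℕ => q ^ (-(d k * p)) *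
    (tBinom (q ^ d k) r p * M (u + v + (p : ℤ) • column b k))) (r + 1)
  rw [Finset.sum_range_succ, tBinom_eq_zero _ (Nat.lt_succ_self r), zero_mul, mul_zero,
    add_zero] at hlast
  rw [Finset.sum_range_succ' _ (r + 1), Finset.sum_mul]
  simp only [hpas, t3]
  rw [← Finset.mul_sum, Finset.sum_add_distrib, Finset.sum_add_distrib, add_right_comm, hlast]
  simp [tBinom_zero_right]

end Mutation

end Frames

/-! ### Mutation preserves toric frames and undoes itself on the exchanged variable -/

section FrameMutation

variable {n : ℕ} {K : Type} [DivisionRing K]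
variable {q : K} {d : Fin n → ℤ} {k : Fin n} {M : (Idx n → ℤ) → K}
  {b : Matrix (Idx n) (Fin n) ℤ} {Ω : (Idx n → ℤ) →ₗ[ℤ] (Idx n → ℤ) →ₗ[ℤ] ℤ}

/-- The relation says that y semiconjugates q^m x to x, and semiconjugation passes to integer
powers. -/
theorem IsQuantumParam.zpow_quasi_comm (hq : IsQuantumParam q) {x y : K} {m : ℤ}
    (h : x * y = q ^ m * (y * x)) (r : ℤ) : x ^ r * y = q ^ (r * m) * (y * x ^ r) := by
  have h1 : SemiconjBy y (q ^ m * x) x := by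
    rw [SemiconjBy, h, hq.mul_zpow_mul]
  have h2 := (h1.zpow_right₀ r).eq
  rw [Commute.mul_zpow (hq.zpow_comm m x), ← zpow_mul, hq.mul_zpow_mul, mul_comm m] at h2
  exact h2.symm

theorem IsToricFrame.formMutate_skew (h : IsToricFrame q M Ω) (c c' : Idx n → ℤ) :
    formMutate k b Ω c c' = -formMutate k b Ω c' c := by
  rw [formMutate_apply, formMutate_apply, h.skew]

variable (hq : IsQuantumParam q) (hd : ∀ i, 0 < d i) (h : IsToricFrame q M Ω)
  (hc : IsCompatible d b Ω)
include hq hd h hc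

/-- The exponents of the exchange monomials differ by b^k, and Ω(b^k, e) = d_k e_k = 0, so both
quasi-commute with M(e) with the same exponent. -/
theorem frameMutatePos_basisVec_mul {e : Idx n → ℤ} (he : e (Sum.inl k) = 0) :
    frameMutatePos q d k M b (basisVec (Sum.inl k)) * M e =
      q ^ (2 * formMutate k b Ω (basisVec (Sum.inl k)) e) *
        (M e * frameMutatePos q d k M b (basisVec (Sum.inl k))) := by
  have hb := hc.diag hd h k
  rw [frameMutatePos_basisVec hq hd h hc, posColumn_one, ← add_assoc, ← mutE_mulVec_basisVec hb,
    formMutate_apply, mutE_mulVec_of_eq_zero he, add_mul, h.quasi_comm hq _ e,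
    h.quasi_comm hq _ e, map_add, LinearMap.add_apply, hc, he, mul_zero, add_zero, ← mul_add,
    ← mul_add]

theorem frameMutatePos_add_smul {e : Idx n → ℤ} (he : e (Sum.inl k) = 0) (r : ℕ) :
    frameMutatePos q d k M b (e + (r : ℤ) • basisVec (Sum.inl k)) =
      q ^ (-(r * formMutate k b Ω e (basisVec (Sum.inl k)))) *
        (M e * frameMutatePos q d k M b (basisVec (Sum.inl k)) ^ (r : ℤ)) := by
  have hs := h.formMutate_skew (k := k) (b := b) (basisVec (Sum.inl k)) (basisVec (Sum.inl k))
  induction r with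
  | zero => simp [frameMutatePos_of_eq_zero he]
  | succ r ih =>
    have h1 := frameMutatePos_mul_basisVec (k := k) hq hd h hc
      (c := e + (r : ℤ) • basisVec (Sum.inl k)) (by simp [he])
    have h2 : e + ((r + 1 : ℕ) : ℤ) • basisVec (Sum.inl k) =
        e + (r : ℤ) • basisVec (Sum.inl k) + basisVec (Sum.inl k) := by
      push_cast; module
    have h3 : formMutate k b Ω (e + (r : ℤ) • basisVec (Sum.inl k)) (basisVec (Sum.inl k)) =
        formMutate k b Ω e (basisVec (Sum.inl k)) := by
      rw [map_add, map_smul, LinearMap.add_apply, LinearMap.smul_apply]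
      have : formMutate k b Ω (basisVec (Sum.inl k)) (basisVec (Sum.inl k)) = 0 := by omega
      simp [this]
    rw [h3] at h1
    rw [h2]
    refine mul_left_cancel₀ (zpow_ne_zero (formMutate k b Ω e (basisVec (Sum.inl k))) hq.ne_zero) ?_
    rw [← h1, ih, hq.zpow_mul_zpow_mul, mul_assoc, mul_assoc, Nat.cast_succ,
      zpow_add_one₀ (frameMutatePos_basisVec_ne_zero hq hd h hc)]
    congr 2
    ring

/-- A closed form for M': it is determined by M on the hyperplane c_k = 0 and by the single new
variable, with no binomials left. -/
theorem frameMutate_add_smul {e : Idx n → ℤ} (he : e (Sum.inl k) = 0) (m : ℤ) :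
    frameMutate q d k M b (e + m • basisVec (Sum.inl k)) =
      q ^ (-(m * formMutate k b Ω e (basisVec (Sum.inl k)))) *
        (M e * frameMutatePos q d k M b (basisVec (Sum.inl k)) ^ m) := by
  have hm : (e + m • basisVec (Sum.inl k)) (Sum.inl k) = m := by simp [he]
  rw [frameMutate, hm]
  split_ifs with h0
  · lift m to ℕ using h0
    exact frameMutatePos_add_smul hq hd h hc he m
  · obtain ⟨r, hr⟩ := Int.eq_ofNat_of_zero_le (show 0 ≤ -m by omega)
    obtain rfl : m = -r := by omega
    have h1 : -(e + (-(r : ℤ)) • basisVec (Sum.inl k)) =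
        -e + (r : ℤ) • basisVec (Sum.inl k) := by module
    -- Inversion reverses the two factors; quasi-commutation restores their order and accounts for
    -- the sign of the exponent.
    rw [h1, frameMutatePos_add_smul hq hd h hc (by simp [he]), h.map_neg, mul_inv_rev, mul_inv_rev,
      inv_inv, ← zpow_neg, ← zpow_neg, ← hq.zpow_comm,
      hq.zpow_quasi_comm (frameMutatePos_basisVec_mul hq hd h hc he), hq.zpow_mul_zpow_mul,
      h.formMutate_skew (basisVec _) e, map_neg, LinearMap.neg_apply]
    congr 2
    ring

/-- In the closed form `frameMutate_add_smul`, the product rule amounts to moving a power of the new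
variable past M(e'). -/
theorem IsToricFrame.mutate (k : Fin n) :
    IsToricFrame q (frameMutate q d k M b) (formMutate k b Ω) := by
  have hX := frameMutatePos_basisVec_ne_zero (k := k) hq hd h hc
  have hdec (c : Idx n → ℤ) : ∃ e m, e (Sum.inl k) = 0 ∧ c = e + m • basisVec (Sum.inl k) :=
    ⟨c - c (Sum.inl k) • basisVec (Sum.inl k), c (Sum.inl k), by simp, by module⟩
  refine ⟨fun c => ?_, fun c c' => ?_, h.formMutate_skew⟩
  · obtain ⟨e, m, he, rfl⟩ := hdec c
    rw [frameMutate_add_smul hq hd h hc he]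
    exact mul_ne_zero (zpow_ne_zero _ hq.ne_zero) (mul_ne_zero (h.ne_zero _) (zpow_ne_zero _ hX))
  · obtain ⟨e, m, he, rfl⟩ := hdec c
    obtain ⟨e', m', he', rfl⟩ := hdec c'
    have h1 : e + m • basisVec (Sum.inl k) + (e' + m' • basisVec (Sum.inl k)) =
        e + e' + (m + m') • basisVec (Sum.inl k) := by module
    have hee : formMutate k b Ω e e' = Ω e e' := by
      rw [formMutate_apply, mutE_mulVec_of_eq_zero he, mutE_mulVec_of_eq_zero he']
    have hs := h.formMutate_skew (k := k) (b := b) (basisVec (Sum.inl k)) (basisVec (Sum.inl k))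
    have hs0 : formMutate k b Ω (basisVec (Sum.inl k)) (basisVec (Sum.inl k)) = 0 := by omega
    have hs' := h.formMutate_skew (k := k) (b := b) (basisVec (Sum.inl k)) e'
    rw [h1, frameMutate_add_smul hq hd h hc he, frameMutate_add_smul hq hd h hc he',
      frameMutate_add_smul hq hd h hc (by simp [he, he']), hq.mul_zpow_mul, mul_assoc, mul_assoc,
      ← mul_assoc _ (M e'), hq.zpow_quasi_comm (frameMutatePos_basisVec_mul hq hd h hc he'),
      mul_assoc, mul_assoc, ← zpow_add₀ hX, hq.mul_zpow_mul _ (M e), ← mul_assoc (M e), h.mul,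
      hq.zpow_mul_zpow_mul, mul_assoc, hq.zpow_mul_zpow_mul, hq.zpow_mul_zpow_mul,
      hq.zpow_mul_zpow_mul]
    congr 2
    simp only [_root_.map_add, map_smul, LinearMap.add_apply, LinearMap.smul_apply, hee, hs0, hs',
      smul_eq_mul]
    ring

/-- Mutation is involutive on the cluster variable that it exchanges. -/
theorem basisVec_eq_frameMutate (k : Fin n) : M (basisVec (Sum.inl k)) =
    frameMutate q d k M b (-basisVec (Sum.inl k) + posColumn 1 (mutMatrix k b) k) +
      frameMutate q d k M b (-basisVec (Sum.inl k) + posColumn (-1) (mutMatrix k b) k) := by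
  have hb := hc.diag hd h k
  have h' := IsToricFrame.mutate hq hd h hc k
  have hX := frameMutate_basisVec (k := k) hq hd h hc
  refine mul_left_cancel₀ (h'.ne_zero (basisVec (Sum.inl k))) ?_
  -- Both products equal the same power of q times M(∑[ε b_ik]_+ e_i), on which M and M' agree since
  -- its k-th coordinate is 0. Summing over ε and cancelling M'(e_k) gives the claim.
  have key (ε : ℤ) (hε : Ω (posColumn (-1) b k) (posColumn ε b k) = 0) :
      M (-basisVec (Sum.inl k) + posColumn ε b k) * M (basisVec (Sum.inl k)) =
      frameMutate q d k M b (basisVec (Sum.inl k)) *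
        frameMutate q d k M b (-basisVec (Sum.inl k) + posColumn ε b k) := by
    rw [h.mul, h'.mul, formMutate_apply, Matrix.mulVec_add, Matrix.mulVec_neg,
      mutE_mulVec_basisVec hb, mutE_mulVec_of_eq_zero (posColumn_self ε hb)]
    have e1 : -basisVec (Sum.inl k) + posColumn ε b k + basisVec (Sum.inl k) =
      posColumn ε b k := by module
    rw [e1, add_neg_cancel_left, frameMutate_of_eq_zero (posColumn_self ε hb)]
    congr 2
    simp only [map_add, map_neg, LinearMap.add_apply, LinearMap.neg_apply, h.form_self, hε,
      h.skew (posColumn _ b k) (basisVec (Sum.inl k))]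
    ring
  have h0 : Ω (posColumn (-1) b k) (posColumn 1 b k) = 0 := by
    rw [posColumn_one, map_add, h.form_self, h.skew, hc, posColumn_self _ hb]; simp
  rw [mul_add, posColumn_mutMatrix, posColumn_mutMatrix, neg_neg, ← key 1 h0,
    ← key (-1) (h.form_self _), ← add_mul, add_comm (M _), hX, add_comm]

end FrameMutation

/-! ### Degrees of ordinary cluster variables and g-vectors -/

section Degrees

variable {n : ℕ} {B : Matrix (Fin n) (Fin n) ℤ}

/-- `f` is a quotient of homogeneous polynomials with positive values at `(1, …, 1)`, whose degrees
differ by `g`. -/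
def HasPosDegree (B : Matrix (Fin n) (Fin n) ℤ) (f : ClusterField n) (g : Fin n → ℤ) : Prop :=
  ∃ (P Q : MvPolynomial (Idx n) ℤ) (a b : Fin n → ℤ),
    0 < MvPolynomial.eval 1 P ∧ 0 < MvPolynomial.eval 1 Q ∧
    P.IsWeightedHomogeneous (gWeight B) a ∧ Q.IsWeightedHomogeneous (gWeight B) b ∧
    f = algebraMap _ (ClusterField n) P / algebraMap _ (ClusterField n) Q ∧ g = a - b

theorem ne_zero_of_eval_pos {P : MvPolynomial (Idx n) ℤ} (h : 0 < MvPolynomial.eval 1 P) :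
    P ≠ 0 := by
  rintro rfl; simp at h

theorem algebraMap_ne_zero_of_eval_pos {P : MvPolynomial (Idx n) ℤ}
    (h : 0 < MvPolynomial.eval 1 P) : algebraMap _ (ClusterField n) P ≠ 0 :=
  (map_ne_zero_iff _ (IsFractionRing.injective _ _)).2 (ne_zero_of_eval_pos h)

namespace HasPosDegree

variable {f f' : ClusterField n} {g g' : Fin n → ℤ}

theorem hasDegree (h : HasPosDegree B f g) : HasDegree B f g := by
  obtain ⟨P, Q, a, b, hP, hQ, h⟩ := h
  exact ⟨P, Q, a, b, ne_zero_of_eval_pos hP, ne_zero_of_eval_pos hQ, h⟩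

theorem one : HasPosDegree B 1 0 :=
  ⟨1, 1, 0, 0, by simp, by simp, MvPolynomial.isWeightedHomogeneous_one _ _,
    MvPolynomial.isWeightedHomogeneous_one _ _, by simp, by simp⟩

theorem X (i : Idx n) :
    HasPosDegree B (algebraMap (MvPolynomial (Idx n) ℤ) _ (MvPolynomial.X i)) (gWeight B i) :=
  ⟨MvPolynomial.X i, 1, gWeight B i, 0, by simp, by simp,
    MvPolynomial.isWeightedHomogeneous_X _ _ _, MvPolynomial.isWeightedHomogeneous_one _ _,
    by simp, by simp⟩

theorem mul (h : HasPosDegree B f g) (h' : HasPosDegree B f' g') :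
    HasPosDegree B (f * f') (g + g') := by
  obtain ⟨P, Q, a, b, hP, hQ, hPa, hQb, rfl, rfl⟩ := h
  obtain ⟨P', Q', a', b', hP', hQ', hPa', hQb', rfl, rfl⟩ := h'
  refine ⟨P * P', Q * Q', a + a', b + b', ?_, ?_, hPa.mul hPa', hQb.mul hQb', ?_, by abel⟩
  · rw [map_mul]; exact mul_pos hP hP'
  · rw [map_mul]; exact mul_pos hQ hQ'
  · rw [map_mul, map_mul, div_mul_div_comm]

theorem inv (h : HasPosDegree B f g) : HasPosDegree B f⁻¹ (-g) := by
  obtain ⟨P, Q, a, b, hP, hQ, hPa, hQb, rfl, rfl⟩ := h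
  exact ⟨Q, P, b, a, hQ, hP, hQb, hPa, by rw [inv_div], by abel⟩

/-- Positivity at (1, …, 1) survives cross-multiplication, so a sum cannot cancel to zero. This is
what the notion adds to `HasDegree`. -/
theorem add (h : HasPosDegree B f g) (h' : HasPosDegree B f' g) :
    HasPosDegree B (f + f') g := by
  obtain ⟨P, Q, a, b, hP, hQ, hPa, hQb, rfl, rfl⟩ := h
  obtain ⟨P', Q', a', b', hP', hQ', hPa', hQb', rfl, hg⟩ := h'
  refine ⟨P * Q' + Q * P', Q * Q', a + b', b + b', ?_, ?_, (hPa.mul hQb').add ?_,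
    hQb.mul hQb', ?_, by abel⟩
  · rw [map_add, map_mul, map_mul]; exact add_pos (mul_pos hP hQ') (mul_pos hQ hP')
  · rw [map_mul]; exact mul_pos hQ hQ'
  · have : a + b' = b + a' := by
      have := sub_eq_sub_iff_add_eq_add.1 hg
      rw [this, add_comm]
    rw [this]
    exact hQb.mul hPa'
  · rw [map_add, map_mul, map_mul, map_mul, div_add_div _ _ (algebraMap_ne_zero_of_eval_pos hQ)
      (algebraMap_ne_zero_of_eval_pos hQ')]

theorem pow (h : HasPosDegree B f g) (m : ℕ) : HasPosDegree B (f ^ m) (m • g) := by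
  induction m with
  | zero => simpa using one
  | succ m ih => rw [pow_succ, succ_nsmul]; exact ih.mul h

theorem zpow (h : HasPosDegree B f g) (m : ℤ) : HasPosDegree B (f ^ m) (m • g) := by
  obtain ⟨r, rfl | rfl⟩ := m.eq_nat_or_neg
  · simpa using h.pow r
  · simpa using (h.pow r).inv

theorem prod {ι : Type} (s : Finset ι) {f : ι → ClusterField n} {g : ι → Fin n → ℤ}
    (h : ∀ i, HasPosDegree B (f i) (g i)) :
    HasPosDegree B (∏ i ∈ s, f i) (∑ i ∈ s, g i) := by
  classical
  induction s using Finset.induction_on with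
  | empty => simpa using one
  | insert i s hi ih => rw [Finset.prod_insert hi, Finset.sum_insert hi]; exact (h i).mul ih

end HasPosDegree

/-- After cross-multiplication, one nonzero polynomial is homogeneous of two degrees, which must
coincide. -/
theorem HasDegree.unique {f : ClusterField n} {g g' : Fin n → ℤ} (h : HasDegree B f g)
    (h' : HasDegree B f g') : g = g' := by
  obtain ⟨P, Q, a, b, hP, hQ, hPa, hQb, rfl, rfl⟩ := h
  obtain ⟨P', Q', a', b', hP', hQ', hPa', hQb', hf, rfl⟩ := h'
  have hne {R : MvPolynomial (Idx n) ℤ} (hR : R ≠ 0) : algebraMap _ (ClusterField n) R ≠ 0 :=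
    (map_ne_zero_iff _ (IsFractionRing.injective _ _)).2 hR
  rw [div_eq_div_iff (hne hQ) (hne hQ'), ← map_mul, ← map_mul] at hf
  have hf' := IsFractionRing.injective _ (ClusterField n) hf
  have h1 := hPa.mul hQb'
  have h2 := hPa'.mul hQb
  rw [hf'] at h1
  exact sub_eq_sub_iff_add_eq_add.2
    (MvPolynomial.IsWeightedHomogeneous.inj_right (mul_ne_zero hP' hQ) h1 h2)

/-- A linear map that gives the degrees of the monomials in the extended cluster reached along the
path `w` and vanishes on the columns of the exchange matrix. -/
structure IsDegreeMap (B : Matrix (Fin n) (Fin n) ℤ) (w : List (Fin n))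
    (D : (Idx n → ℤ) →ₗ[ℤ] (Fin n → ℤ)) : Prop where
  degree : ∀ i, HasPosDegree B ((principalSeed B w).x i) (D (basisVec i))
  column : ∀ j, D (column (principalSeed B w).b j) = 0

theorem linearCombination_gWeight_column (j : Fin n) :
    Fintype.linearCombination ℤ (gWeight B) (column (principalMatrix B) j) = 0 := by
  ext i
  simp [Fintype.linearCombination_apply, column, principalMatrix, gWeight, Pi.single_apply,
    Matrix.one_apply]

theorem isDegreeMap_nil : IsDegreeMap B [] (Fintype.linearCombination ℤ (gWeight B)) where
  degree i := by
    rw [Fintype.linearCombination_apply_single, one_smul]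
    exact HasPosDegree.X i
  column j := linearCombination_gWeight_column j

/-- The exchange binomial is homogeneous: its two exponents differ by a column, which D kills. -/
theorem IsDegreeMap.posColumn_eq {w : List (Fin n)} {D : (Idx n → ℤ) →ₗ[ℤ] (Fin n → ℤ)}
    (h : IsDegreeMap B w D) (k : Fin n) :
    D (posColumn 1 (principalSeed B w).b k) = D (posColumn (-1) (principalSeed B w).b k) := by
  rw [posColumn_one, map_add, h.column, add_zero]

theorem principalSeed_x_of_ne (w : List (Fin n)) {k : Fin n} {i : Idx n} (hi : i ≠ Sum.inl k) :
    (principalSeed B (k :: w)).x i = (principalSeed B w).x i :=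
  Function.update_of_ne hi _ _

/-- The new variable has the common degree of the exchange monomials minus that of the old one,
which is D(E e_k); the columns stay in the kernel because E maps mutated columns into the span of
old ones. -/
theorem IsDegreeMap.cons {w : List (Fin n)} {D : (Idx n → ℤ) →ₗ[ℤ] (Fin n → ℤ)}
    (h : IsDegreeMap B w D) {k : Fin n} (hb : (principalSeed B w).b (Sum.inl k) k = 0) :
    IsDegreeMap B (k :: w) (D ∘ₗ (mutE k (principalSeed B w).b).mulVecLin) where
  degree i := by
    rw [LinearMap.comp_apply, Matrix.mulVecLin_apply]
    by_cases hi : i = Sum.inl k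
    · subst hi
      rw [mutE_mulVec_basisVec hb, map_add, map_neg]
      have hx : (principalSeed B (k :: w)).x (Sum.inl k) = _ := Function.update_self _ _ _
      rw [hx]
      have hs (ε : ℤ) : HasPosDegree B
          (∏ i, (principalSeed B w).x i ^ plusPart (ε * (principalSeed B w).b i k))
          (D (posColumn ε (principalSeed B w).b k)) := by
        have := HasPosDegree.prod Finset.univ
          fun i => (h.degree i).zpow (plusPart (ε * (principalSeed B w).b i k))
        rw [pi_eq_sum_univ' (posColumn ε (principalSeed B w).b k), map_sum]
        simp only [map_smul]
        exact this
      have h1 := hs 1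
      have h2 := hs (-1)
      rw [h.posColumn_eq] at h1
      simp only [one_mul] at h1
      simp only [neg_mul, one_mul] at h2
      exact (h.degree _).inv.mul (h1.add h2)
    · rw [mutE_mulVec_of_eq_zero (by simp [Ne.symm hi])]
      rw [principalSeed_x_of_ne w hi]
      exact h.degree i
  column j := by
    rw [LinearMap.comp_apply, Matrix.mulVecLin_apply]
    change D (mutE k _ *ᵥ QCA.column (mutMatrix k _) j) = 0
    by_cases hj : j = k
    · subst hj
      rw [mutE_mulVec_column_self hb, map_neg, h.column, neg_zero]
    · rw [mutE_mulVec_column hj hb, map_add, map_smul, h.column, h.column, smul_zero, add_zero]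

theorem principalSeed_x_inr (w : List (Fin n)) (j : Fin n) :
    (principalSeed B w).x (Sum.inr j) =
      algebraMap (MvPolynomial (Idx n) ℤ) _ (MvPolynomial.X (Sum.inr j)) := by
  induction w with
  | nil => rfl
  | cons k w ih =>
    rw [principalSeed_x_of_ne w Sum.inr_ne_inl, ih]

/-- The linear map with `e_j ↦ g_{j;t}` and `e_{n+j} ↦ deg y_j`. -/
def gDegree (B : Matrix (Fin n) (Fin n) ℤ) (t : TreeVertex n) :
    (Idx n → ℤ) →ₗ[ℤ] (Fin n → ℤ) :=
  Fintype.linearCombination ℤ (Sum.elim (gVector B t) fun j i => -B i j)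

theorem gDegree_inl (t : TreeVertex n) (j : Fin n) :
    gDegree B t (basisVec (Sum.inl j)) = gVector B t j := by
  rw [gDegree, Fintype.linearCombination_apply_single, one_smul]; rfl

theorem gDegree_apply (t : TreeVertex n) (c : Idx n → ℤ) :
    gDegree B t c = ∑ i, c (Sum.inl i) • gVector B t i - B *ᵥ fun j => c (Sum.inr j) := by
  ext i
  simp [gDegree, Fintype.linearCombination_apply, Matrix.mulVec, dotProduct, mul_comm,
    sub_eq_add_neg]

/-- Degrees are unique, so the chosen g-vectors agree with any degree map; the coefficient variables
never change. -/
theorem IsDegreeMap.eq_gDegree {t : TreeVertex n} {D : (Idx n → ℤ) →ₗ[ℤ] (Fin n → ℤ)}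
    (h : IsDegreeMap B t.1 D) : D = gDegree B t := by
  refine LinearMap.pi_ext' fun i => LinearMap.ext_ring ?_
  change D (basisVec i) = gDegree B t (basisVec i)
  rcases i with j | j
  · rw [gDegree_inl]
    have h1 := (h.degree (Sum.inl j)).hasDegree
    exact h1.unique (Classical.epsilon_spec ⟨_, h1⟩)
  · rw [gDegree, Fintype.linearCombination_apply_single, one_smul]
    have h1 := (h.degree (Sum.inr j)).hasDegree
    rw [principalSeed_x_inr] at h1
    exact h1.unique (HasPosDegree.X (Sum.inr j)).hasDegree

theorem isDegreeMap_gDegree (hb : ∀ w k, (principalSeed B w).b (Sum.inl k) k = 0)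
    (t : TreeVertex n) : IsDegreeMap B t.1 (gDegree B t) := by
  obtain ⟨D, hD⟩ : ∃ D, IsDegreeMap B t.1 D := by
    induction t.1 with
    | nil => exact ⟨_, isDegreeMap_nil⟩
    | cons k w ih => obtain ⟨D, hD⟩ := ih; exact ⟨_, hD.cons (hb w k)⟩
  rwa [← hD.eq_gDegree]

theorem gDegree_cons (hb : ∀ w k, (principalSeed B w).b (Sum.inl k) k = 0)
    {t t' : TreeVertex n} {k : Fin n} (h : t'.1 = k :: t.1) (c : Idx n → ℤ) :
    gDegree B t' c = gDegree B t (mutE k (principalSeed B t.1).b *ᵥ c) := by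
  have h1 := (isDegreeMap_gDegree hb t).cons (hb t.1 k)
  rw [← h] at h1
  rw [← h1.eq_gDegree]; rfl

theorem gDegree_root (c : Idx n → ℤ) :
    gDegree B (TreeVertex.root n) c = Fintype.linearCombination ℤ (gWeight B) c := by
  rw [← IsDegreeMap.eq_gDegree (t := TreeVertex.root n) isDegreeMap_nil]

end Degrees

/-! ### Compatibility and quasi-commutation in the initial frame -/

section Quantum

variable {n : ℕ} (B : Matrix (Fin n) (Fin n) ℤ) (d : Fin n → ℤ) (Λ : Matrix (Fin n) (Fin n) ℤ)

theorem isQuantumParam_qHalf {ι : Type} [Fintype ι] (Λ : Matrix ι ι ℤ) :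
    IsQuantumParam (QSkewField.qHalf Λ) :=
  ⟨QSkewField.qHalf_ne_zero, QSkewField.qHalf_comm, QSkewField.eq_zero_of_qHalf_zpow_eq_one⟩

/-- The bilinear form with matrix `Λ₀`. -/
def form0 : (Idx n → ℤ) →ₗ[ℤ] (Idx n → ℤ) →ₗ[ℤ] ℤ := Matrix.toLinearMap₂' ℤ (lambda0 B d Λ)

theorem form0_apply (c c' : Idx n → ℤ) : form0 B d Λ c c' = c ⬝ᵥ lambda0 B d Λ *ᵥ c' :=
  Matrix.toLinearMap₂'_apply' _ _ _

/-- Λ₀ is built so that (B̃⁰)ᵀ Λ₀ = (D 0). This gives compatibility of the initial seed, the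
exponent of L[a] and the exponent λ^ε. -/
theorem form0_principal (x : Fin n → ℤ) (c : Idx n → ℤ) :
    form0 B d Λ (principalMatrix B *ᵥ x) c = ∑ i, x i * c (Sum.inl i) * d i := by
  have h : (principalMatrix B)ᵀ * lambda0 B d Λ =
      Matrix.fromCols (Matrix.diagonal d) (0 : Matrix (Fin n) (Fin n) ℤ) := by
    rw [principalMatrix, lambda0, Matrix.transpose_fromRows, Matrix.fromCols_mul_fromBlocks]
    congr 1
    · simp
    · simp [Matrix.mul_sub, Matrix.mul_assoc]
  rw [form0_apply, ← Matrix.vecMul_transpose, ← Matrix.dotProduct_mulVec, Matrix.mulVec_mulVec, h,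
    Matrix.fromCols_mulVec]
  simp [dotProduct, Matrix.mulVec_diagonal, mul_assoc, mul_comm (d _)]

theorem principalMatrix_mulVec (x : Fin n → ℤ) :
    principalMatrix B *ᵥ x = Sum.elim (B *ᵥ x) x := by
  rw [principalMatrix, Matrix.fromRows_mulVec, Matrix.one_mulVec]

theorem column_principalMatrix (k : Fin n) :
    column (principalMatrix B) k = principalMatrix B *ᵥ Pi.single k 1 := by
  ext i; simp [column]

theorem isCompatible_principal : IsCompatible d (principalMatrix B) (form0 B d Λ) := by
  intro k c
  rw [column_principalMatrix, form0_principal]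
  simp [Pi.single_apply, mul_comm]

variable {B d Λ}

/-! ### Quantum seeds, cluster variables and g-vectors along an edge -/

section Invariants

variable (hB : (Matrix.diagonal d * B)ᵀ = -(Matrix.diagonal d * B)) (hΛ : Λᵀ = -Λ)
include hB hΛ

theorem lambda0_transpose : (lambda0 B d Λ)ᵀ = -lambda0 B d Λ := by
  have hB' : Bᵀ * Matrix.diagonal d = -(Matrix.diagonal d * B) := by
    rw [← hB, Matrix.transpose_mul, Matrix.diagonal_transpose]
  rw [lambda0, Matrix.fromBlocks_transpose, Matrix.fromBlocks_neg]
  simp only [Matrix.transpose_add, Matrix.transpose_sub, Matrix.transpose_neg,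
    Matrix.transpose_mul, Matrix.transpose_transpose, Matrix.diagonal_transpose, hΛ, hB',
    Matrix.mul_neg, Matrix.neg_mul, Matrix.mul_assoc]
  congr 1 <;> abel

theorem isToricFrame_frame0 :
    IsToricFrame (QSkewField.qHalf (lambda0 B d Λ)) (frame0 B d Λ) (form0 B d Λ) where
  ne_zero c := QSkewField.mono_ne_zero _
  mul c c' := by rw [form0_apply]; exact QSkewField.X_mul_X c c'
  skew c c' := by
    rw [form0_apply, form0_apply, dotProduct_comm, ← Matrix.vecMul_transpose,
      lambda0_transpose hB hΛ, Matrix.vecMul_neg, neg_dotProduct, Matrix.dotProduct_mulVec]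

variable (hd : ∀ i, 0 < d i)
include hd

/-- Every quantum seed is a toric frame with a compatible exchange matrix. -/
theorem exists_form (w : List (Fin n)) : ∃ Ω,
    IsToricFrame (QSkewField.qHalf (lambda0 B d Λ)) (quantumSeed B d Λ w).M Ω ∧
      IsCompatible d (quantumSeed B d Λ w).b Ω := by
  induction w with
  | nil => exact ⟨form0 B d Λ, isToricFrame_frame0 hB hΛ, isCompatible_principal B d Λ⟩
  | cons k w ih =>
    obtain ⟨Ω, h, hc⟩ := ih
    exact ⟨formMutate k (quantumSeed B d Λ w).b Ω,
      IsToricFrame.mutate (isQuantumParam_qHalf _) hd h hc k, hc.mutate hd h k⟩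

omit hB hΛ hd in
theorem quantumSeed_b (w : List (Fin n)) :
    (quantumSeed B d Λ w).b = (principalSeed B w).b := by
  induction w with
  | nil => rfl
  | cons k w ih => exact congrArg (mutMatrix k) ih

theorem quantumSeed_diag (w : List (Fin n)) (k : Fin n) :
    (quantumSeed B d Λ w).b (Sum.inl k) k = 0 := by
  obtain ⟨Ω, h, hc⟩ := exists_form hB hΛ hd w
  exact hc.diag hd h k

theorem principalSeed_diag (w : List (Fin n)) (k : Fin n) :
    (principalSeed B w).b (Sum.inl k) k = 0 := by
  rw [← quantumSeed_b (d := d) (Λ := Λ)]; exact quantumSeed_diag hB hΛ hd w k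

-- Mutation in direction k changes a frame only off c_k = 0, so frozen monomials are the same in all
-- seeds.
omit hB hΛ hd in
theorem quantumSeed_M_of_eq_zero (w : List (Fin n)) {c : Idx n → ℤ}
    (hc : ∀ i, c (Sum.inl i) = 0) : (quantumSeed B d Λ w).M c = frame0 B d Λ c := by
  induction w with
  | nil => rfl
  | cons k w ih => rw [← ih]; exact frameMutate_of_eq_zero (hc k)

omit hB hΛ hd in
theorem clusterVar_edge_of_ne {k : Fin n} {t t' : TreeVertex n} (he : TreeVertex.Edge k t t')
    {j : Fin n} (hj : j ≠ k) : clusterVar B d Λ t' j = clusterVar B d Λ t j := by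
  have h0 : (Pi.single (Sum.inl j) 1 : Idx n → ℤ) (Sum.inl k) = 0 := by simp [hj.symm]
  rcases he with h | h
  · unfold clusterVar; rw [h]; exact frameMutate_of_eq_zero h0
  · unfold clusterVar; rw [h]; exact (frameMutate_of_eq_zero h0).symm

/-- Edges are unoriented. If t' is the longer word this is the definition of mutation; otherwise it
is involutivity, `basisVec_eq_frameMutate`. -/
theorem clusterVar_edge {k : Fin n} {t t' : TreeVertex n} (he : TreeVertex.Edge k t t') :
    clusterVar B d Λ t' k =
      (quantumSeed B d Λ t.1).M
        (-basisVec (Sum.inl k) + posColumn 1 (quantumSeed B d Λ t.1).b k) +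
      (quantumSeed B d Λ t.1).M
        (-basisVec (Sum.inl k) + posColumn (-1) (quantumSeed B d Λ t.1).b k) := by
  rcases he with h | h
  · obtain ⟨Ω, hM, hc⟩ := exists_form hB hΛ hd t.1
    unfold clusterVar
    rw [h]
    exact frameMutate_basisVec (isQuantumParam_qHalf _) hd hM hc
  · obtain ⟨Ω, hM, hc⟩ := exists_form hB hΛ hd t'.1
    rw [h]
    exact basisVec_eq_frameMutate (isQuantumParam_qHalf _) hd hM hc k

theorem gVector_edge_of_ne {k : Fin n} {t t' : TreeVertex n} (he : TreeVertex.Edge k t t')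
    {j : Fin n} (hj : j ≠ k) : gVector B t' j = gVector B t j := by
  have hb := principalSeed_diag hB hΛ hd
  have h0 : (basisVec (Sum.inl j) : Idx n → ℤ) (Sum.inl k) = 0 := by simp [hj.symm]
  rw [← gDegree_inl, ← gDegree_inl]
  rcases he with h | h
  · rw [gDegree_cons hb h, mutE_mulVec_of_eq_zero h0]
  · rw [gDegree_cons hb h, mutE_mulVec_of_eq_zero h0]

/-- Both exchange monomials have the same degree, so either sign may be used; the same fact handles
the edge traversed towards the root. -/
theorem gVector_edge {k : Fin n} {t t' : TreeVertex n} (he : TreeVertex.Edge k t t')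
    {ε : ℤ} (hε : ε = 1 ∨ ε = -1) : gVector B t' k =
      gDegree B t (-basisVec (Sum.inl k) + posColumn ε (quantumSeed B d Λ t.1).b k) := by
  have hb := principalSeed_diag hB hΛ hd
  have hsign (t : TreeVertex n) : gDegree B t (posColumn ε (principalSeed B t.1).b k) =
      gDegree B t (posColumn (-1) (principalSeed B t.1).b k) := by
    rcases hε with rfl | rfl
    · exact (isDegreeMap_gDegree hb t).posColumn_eq k
    · rfl
  rw [quantumSeed_b, map_add, hsign, ← gDegree_inl]
  rcases he with h | h
  · rw [gDegree_cons hb h, mutE_mulVec_basisVec (hb _ _), map_add]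
  · have h1 : (principalSeed B t.1).b = mutMatrix k (principalSeed B t'.1).b := by rw [h]; rfl
    rw [h1, posColumn_mutMatrix, neg_neg, map_neg, gDegree_cons hb h (posColumn _ _ _),
      gDegree_cons hb h, mutE_mulVec_basisVec (hb _ _), mutE_mulVec_of_eq_zero
      (posColumn_self _ (hb _ _)), (isDegreeMap_gDegree hb t').posColumn_eq k]
    simp

-- The chosen exponent is unique because q^(1/2) has infinite order and frame monomials are nonzero.
omit hB hΛ hd in
theorem frameForm_eq {M : (Idx n → ℤ) → Ambient B d Λ}
    {Ω : (Idx n → ℤ) →ₗ[ℤ] (Idx n → ℤ) →ₗ[ℤ] ℤ}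
    (h : IsToricFrame (QSkewField.qHalf (lambda0 B d Λ)) M Ω) (i j : Idx n) :
    frameForm M i j = Ω (basisVec i) (basisVec j) := by
  have hq := isQuantumParam_qHalf (lambda0 B d Λ)
  have h1 := h.quasi_comm hq (basisVec i) (basisVec j)
  have h2 : M (basisVec i) * M (basisVec j) = _ := Classical.epsilon_spec
    (p := fun l : ℤ => M (Pi.single i 1) * M (Pi.single j 1) =
      QSkewField.qHalf (lambda0 B d Λ) ^ (2 * l) * (M (Pi.single j 1) * M (Pi.single i 1)))
    ⟨_, h1⟩
  rw [h2] at h1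
  have h3 := hq.zpow_inj
    (mul_right_cancel₀ (mul_ne_zero (h.ne_zero (basisVec j)) (h.ne_zero (basisVec i))) h1)
  have h4 : 2 * frameForm M i j = 2 * Ω (basisVec i) (basisVec j) := h3
  omega

end Invariants

/-! ### The extended `g`-vectors -/

variable (B) in
/-- The linear map with `e_i ↦ g_{i;t}` for all `i ∈ [1, 2n]`. -/
def gExtMap (t : TreeVertex n) : (Idx n → ℤ) →ₗ[ℤ] (Idx n → ℤ) :=
  Fintype.linearCombination ℤ (gVectorExt B t)

theorem gExtMap_basisVec (t : TreeVertex n) (i : Idx n) :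
    gExtMap B t (basisVec i) = gVectorExt B t i := by
  rw [gExtMap, Fintype.linearCombination_apply_single, one_smul]

theorem gExtMap_eq (t : TreeVertex n) (c : Idx n → ℤ) :
    gExtMap B t c = Sum.elim (∑ i, c (Sum.inl i) • gVector B t i) fun j => c (Sum.inr j) := by
  ext i
  rcases i with i | i
  · simp [gExtMap, Fintype.linearCombination_apply, gVectorExt]
  · simp [gExtMap, Fintype.linearCombination_apply, gVectorExt, Pi.single_apply]

/-- Since deg y_j is minus the j-th column of B⁰, replacing e_{n+j} by the j-th column of B̃⁰ is
compensated exactly by the degree. This later splits M₀ into a Ŷ-monomial and M₀(g). -/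
theorem gExtMap_eq_add (t : TreeVertex n) (c : Idx n → ℤ) :
    gExtMap B t c =
      (principalMatrix B *ᵥ fun j => c (Sum.inr j)) + Sum.elim (gDegree B t c) 0 := by
  rw [gExtMap_eq, principalMatrix_mulVec, gDegree_apply]
  ext i
  rcases i with i | i <;> simp

theorem gVector_root (j : Fin n) : gVector B (TreeVertex.root n) j = Pi.single j 1 := by
  rw [← gDegree_inl, gDegree_root, Fintype.linearCombination_apply_single, one_smul]
  rfl

/-! ### The substitution `Z ↦ Ŷ` -/

theorem evalYHat_qHalf :
    evalYHat B d Λ (QSkewField.qHalf (zForm B d)) = QSkewField.qHalf (lambda0 B d Λ) := by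
  rw [evalYHat, QSkewField.qHalf_eq_mono, QSkewField.map_mono, QSkewField.qHalf_eq_mono]
  congr 1
  ext1
  · rfl
  · simp [yHatMonomial]

theorem evalYHat_zMon (c : Fin n → ℤ) :
    evalYHat B d Λ (zMon B d c) = frame0 B d Λ (principalMatrix B *ᵥ c) := by
  rw [evalYHat, zMon, QSkewField.X_eq_mono, QSkewField.map_mono, frame0, QSkewField.X_eq_mono]
  rfl

/-! ### Moving frame monomials past F(Ŷ) -/

section Main

variable (hB : (Matrix.diagonal d * B)ᵀ = -(Matrix.diagonal d * B)) (hΛ : Λᵀ = -Λ)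
include hB hΛ

/-- Conjugation by M₀(c) is a homomorphism, so monomials suffice; there `form0_principal` gives the
scalar, which depends only on the first n coordinates of c. -/
theorem frame0_mul_evalYHat (c : Idx n → ℤ) (F : ZField B d) :
    frame0 B d Λ c * evalYHat B d Λ F =
      evalYHat B d Λ (twist B d (fun i => c (Sum.inl i)) F) * frame0 B d Λ c := by
  have h0 := isToricFrame_frame0 hB hΛ
  have hq := isQuantumParam_qHalf (lambda0 B d Λ)
  have h : (QSkewField.conj _ (h0.ne_zero c)).comp (evalYHat B d Λ) =
      (evalYHat B d Λ).comp (twist B d fun i => c (Sum.inl i)) := by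
    refine QSkewField.hom_ext fun m => ?_
    change frame0 B d Λ c * evalYHat B d Λ (QSkewField.mono _ m) * (frame0 B d Λ c)⁻¹ =
      evalYHat B d Λ (twist B d _ (QSkewField.mono _ m))
    rw [mul_inv_eq_iff_eq_mul₀ (h0.ne_zero c), twist, QSkewField.map_mono, evalYHat,
      QSkewField.map_mono, QSkewField.map_mono, QSkewField.mono_eq, QSkewField.mono_eq]
    change frame0 B d Λ c * (_ * frame0 B d Λ (principalMatrix B *ᵥ m.e)) =
      QSkewField.qHalf (lambda0 B d Λ) ^ (m.a - 2 * ∑ i, c (Sum.inl i) * m.e i * d i) *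
        frame0 B d Λ (principalMatrix B *ᵥ m.e) * frame0 B d Λ c
    rw [hq.mul_zpow_mul, h0.quasi_comm hq, hq.zpow_mul_zpow_mul, mul_assoc, h0.skew,
      form0_principal]
    change QSkewField.qHalf (lambda0 B d Λ) ^ (m.a + _) * _ = _
    congr 2
    rw [mul_neg, sub_eq_add_neg]
    simp only [mul_comm (m.e _)]
  have h1 := RingHom.congr_fun h F
  change frame0 B d Λ c * evalYHat B d Λ F * (frame0 B d Λ c)⁻¹ = _ at h1
  rwa [mul_inv_eq_iff_eq_mul₀ (h0.ne_zero c)] at h1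

/-- The factor preceded by i copies of M₀(c) is twisted by i·c; hence the shifts (i - 1)g_j in G_j.
-/
theorem evalYHat_mul_frame0_pow (F : ZField B d) (c : Idx n → ℤ) (r : ℕ) :
    (evalYHat B d Λ F * frame0 B d Λ c) ^ r =
      evalYHat B d Λ (List.ofFn fun i : Fin r =>
        twist B d ((i : ℤ) • fun i => c (Sum.inl i)) F).prod * frame0 B d Λ ((r : ℤ) • c) := by
  have h0 := isToricFrame_frame0 hB hΛ
  induction r with
  | zero => simp [h0.map_zero]
  | succ r ih =>
    have h1 : frame0 B d Λ ((r : ℤ) • c) * frame0 B d Λ c =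
        frame0 B d Λ (((r + 1 : ℕ) : ℤ) • c) := by
      rw [h0.mul, map_smul, LinearMap.smul_apply, h0.form_self, smul_zero, zpow_zero, one_mul]
      congr 1; push_cast; module
    rw [pow_succ, ih, List.ofFn_succ', List.concat_eq_append, List.prod_append, List.prod_singleton,
      map_mul, ← h1, mul_assoc, ← mul_assoc (frame0 B d Λ _),
      frame0_mul_evalYHat hB hΛ]
    simp only [mul_assoc]
    rfl

end Main

end Quantum

/-! ### Bookkeeping of the powers of q -/

section Recurrence

variable {n : ℕ} {B : Matrix (Fin n) (Fin n) ℤ} {d : Fin n → ℤ} {Λ : Matrix (Fin n) (Fin n) ℤ}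

variable (B d Λ) in
/-- The difference between the form `Ω` and the pullback of `Λ₀` along the extended `g`-vectors. -/
def rhoForm (t : TreeVertex n) (Ω : (Idx n → ℤ) →ₗ[ℤ] (Idx n → ℤ) →ₗ[ℤ] ℤ) :
    (Idx n → ℤ) →ₗ[ℤ] (Idx n → ℤ) →ₗ[ℤ] ℤ :=
  Ω - (form0 B d Λ).compl₁₂ (gExtMap B t) (gExtMap B t)

theorem rhoForm_apply (t : TreeVertex n) (Ω : (Idx n → ℤ) →ₗ[ℤ] (Idx n → ℤ) →ₗ[ℤ] ℤ)
    (c c' : Idx n → ℤ) :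
    rhoForm B d Λ t Ω c c' = Ω c c' - form0 B d Λ (gExtMap B t c) (gExtMap B t c') := rfl

/-- The part of the exponent of `M_t(-e_k + ∑_i [ε b_ik]_+ e_i)` that precedes the index `m`. -/
def prefixVec (k : Fin n) (a : Idx n → ℤ) (m : ℕ) : Idx n → ℤ :=
  -basisVec (Sum.inl k) +
    ∑ i ∈ Finset.univ.filter fun i : Fin n => i.val < m, a (Sum.inl i) • basisVec (Sum.inl i)

theorem filter_val_lt_succ (i : Fin n) :
    (Finset.univ.filter fun j : Fin n => j.val < i.val + 1) =
      insert i (Finset.univ.filter fun j : Fin n => j.val < i.val) := by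
  ext j
  simp [Fin.ext_iff]
  omega

theorem filter_val_lt (i : Fin n) :
    (Finset.univ.filter fun j : Fin n => j.val < i.val) = Finset.Iio i := by
  ext j; simp

theorem filter_val_lt_card : (Finset.univ.filter fun j : Fin n => j.val < n) = Finset.univ := by
  ext j; simp

theorem prefixVec_succ (k : Fin n) (a : Idx n → ℤ) (i : Fin n) :
    prefixVec k a (i.val + 1) =
      prefixVec k a i.val + a (Sum.inl i) • basisVec (Sum.inl i) := by
  rw [prefixVec, filter_val_lt_succ, Finset.sum_insert (by simp), prefixVec, add_assoc,
    add_comm (_ • _)]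

theorem prefixVec_card_add (k : Fin n) (a : Idx n → ℤ) :
    prefixVec k a n + ∑ j, a (Sum.inr j) • basisVec (Sum.inr j) =
      -basisVec (Sum.inl k) + a := by
  rw [prefixVec, filter_val_lt_card, add_assoc, ← Fintype.sum_sum_type
    (fun i => a i • (basisVec i : Idx n → ℤ))]
  congr 1
  exact (pi_eq_sum_univ' a).symm

theorem gExtMap_prefixVec_inl (t : TreeVertex n) (k : Fin n) (a : Idx n → ℤ) (i : Fin n) :
    (fun l => gExtMap B t (prefixVec k a i.val) (Sum.inl l)) =
      -gVector B t k + ∑ j ∈ Finset.Iio i, a (Sum.inl j) • gVector B t j := by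
  rw [prefixVec, filter_val_lt]
  simp only [map_add, map_neg, map_sum, map_smul, gExtMap_basisVec]
  ext l
  simp [gVectorExt]

/-- The left side is the exponent accumulated while appending the factors one index at a time. Pairs
of frozen indices are absent on the right because the frozen part is appended as a single vector. -/
theorem rhoForm_sum_eq {R : (Idx n → ℤ) →ₗ[ℤ] (Idx n → ℤ) →ₗ[ℤ] ℤ}
    (hR : ∀ c c', R c c' = -R c' c) (k : Fin n) (a : Idx n → ℤ) :
    -(∑ i : Fin n, R (prefixVec k a i.val) (a (Sum.inl i) • basisVec (Sum.inl i))) -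
        R (prefixVec k a n) (∑ j, a (Sum.inr j) • basisVec (Sum.inr j)) =
      (-∑ i, a i * R (basisVec i) (basisVec (Sum.inl k)))
      + (∑ i : Fin n, ∑ j ∈ Finset.Ioi i, a (Sum.inl i) * a (Sum.inl j) *
          R (basisVec (Sum.inl j)) (basisVec (Sum.inl i)))
      + ∑ i : Fin n, ∑ j : Fin n, a (Sum.inl i) * a (Sum.inr j) *
          R (basisVec (Sum.inr j)) (basisVec (Sum.inl i)) := by
  have h1 (s : Finset (Fin n)) (j : Idx n) : R (-basisVec (Sum.inl k) +
      ∑ i ∈ s, a (Sum.inl i) • basisVec (Sum.inl i)) (a j • basisVec j) =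
      a j * R (basisVec j) (basisVec (Sum.inl k)) -
        ∑ i ∈ s, a (Sum.inl i) * a j * R (basisVec j) (basisVec (Sum.inl i)) := by
    rw [hR]
    simp only [map_add, map_neg, map_sum, map_smul, LinearMap.smul_apply, smul_eq_mul,
      neg_add, neg_neg, ← sub_eq_add_neg]
    congr 1
    refine Finset.sum_congr rfl fun i _ => ?_
    ring
  have h2 (i : Fin n) : R (prefixVec k a i.val) (a (Sum.inl i) • basisVec (Sum.inl i)) = _ :=
    (congrArg (fun s => R (-basisVec (Sum.inl k) +
      ∑ i ∈ s, a (Sum.inl i) • basisVec (Sum.inl i)) (a (Sum.inl i) • basisVec (Sum.inl i)))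
      (filter_val_lt i)).trans (h1 (Finset.Iio i) (Sum.inl i))
  have h3 (j : Fin n) : R (prefixVec k a n) (a (Sum.inr j) • basisVec (Sum.inr j)) = _ :=
    (congrArg (fun s => R (-basisVec (Sum.inl k) +
      ∑ i ∈ s, a (Sum.inl i) • basisVec (Sum.inl i)) (a (Sum.inr j) • basisVec (Sum.inr j)))
      filter_val_lt_card).trans (h1 Finset.univ (Sum.inr j))
  rw [map_sum]
  simp only [h2, h3, Finset.sum_sub_distrib, Fintype.sum_sum_type]
  have h4 : (∑ i : Fin n, ∑ j ∈ Finset.Iio i, a (Sum.inl j) * a (Sum.inl i) *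
      R (basisVec (Sum.inl i)) (basisVec (Sum.inl j))) =
      ∑ i : Fin n, ∑ j ∈ Finset.Ioi i, a (Sum.inl i) * a (Sum.inl j) *
          R (basisVec (Sum.inl j)) (basisVec (Sum.inl i)) :=
    Finset.sum_comm' (by simp)
  rw [h4, Finset.sum_comm (s := (Finset.univ : Finset (Fin n))) (t := Finset.univ)
    (f := fun j i => a (Sum.inl i) * a (Sum.inr j) *
          R (basisVec (Sum.inr j)) (basisVec (Sum.inl i)))]
  ring

variable (hB : (Matrix.diagonal d * B)ᵀ = -(Matrix.diagonal d * B)) (hΛ : Λᵀ = -Λ)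
include hB hΛ

/-! ### Expansion of the exchange monomials in the initial frame -/

section Frame

variable {t : TreeVertex n} {Ω : (Idx n → ℤ) →ₗ[ℤ] (Idx n → ℤ) →ₗ[ℤ] ℤ}
  (hM : IsToricFrame (QSkewField.qHalf (lambda0 B d Λ)) (quantumSeed B d Λ t.1).M Ω)
include hM

theorem rhoForm_skew (c c' : Idx n → ℤ) :
    rhoForm B d Λ t Ω c c' = -rhoForm B d Λ t Ω c' c := by
  rw [rhoForm_apply, rhoForm_apply, hM.skew, (isToricFrame_frame0 hB hΛ).skew]
  ring

omit hB hΛ in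
theorem rho_eq_rhoForm (i j : Idx n) :
    rho B d Λ t i j = rhoForm B d Λ t Ω (basisVec i) (basisVec j) := by
  rw [rho, frameForm_eq hM, rhoForm_apply, gExtMap_basisVec, gExtMap_basisVec, form0_apply]

/-- Adding a vector to the exponent of a frame monomial. -/
theorem frame_add {c c' : Idx n → ℤ} {s : ℤ} {H H' : ZField B d}
    (hc : (quantumSeed B d Λ t.1).M c = QSkewField.qHalf (lambda0 B d Λ) ^ s *
      (evalYHat B d Λ H * frame0 B d Λ (gExtMap B t c)))
    (hc' : (quantumSeed B d Λ t.1).M c' =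
      evalYHat B d Λ H' * frame0 B d Λ (gExtMap B t c')) :
    (quantumSeed B d Λ t.1).M (c + c') =
      QSkewField.qHalf (lambda0 B d Λ) ^ (s - rhoForm B d Λ t Ω c c') *
      (evalYHat B d Λ (H * twist B d (fun l => gExtMap B t c (Sum.inl l)) H') *
        frame0 B d Λ (gExtMap B t (c + c'))) := by
  have hq := isQuantumParam_qHalf (lambda0 B d Λ)
  rw [hM.map_add hq, hc, hc', mul_assoc, mul_assoc, ← mul_assoc (frame0 B d Λ _),
    frame0_mul_evalYHat hB hΛ, mul_assoc, (isToricFrame_frame0 hB hΛ).mul, ← mul_assoc,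
    ← mul_assoc, map_add, map_mul]
  generalize evalYHat B d Λ (twist B d _ H') = x
  generalize evalYHat B d Λ H = y
  -- Splitting M_t contributes -Ω(c, c') and merging the initial monomials contributes the Λ₀-value;
  -- together they give minus the value of `rhoForm`.
  rw [mul_assoc, mul_assoc, hq.mul_zpow_mul _ x, hq.mul_zpow_mul _ y, hq.zpow_mul_zpow_mul,
    hq.zpow_mul_zpow_mul, mul_assoc, rhoForm_apply]
  congr 2
  ring

variable (hF : ∀ j, IsQuantumF B d Λ t j (quantumF B d Λ t j))
include hF

/-- Inversion puts M₀(-g_k) on the left; moving it to the right twists F_k⁻¹ by -g_k. -/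
theorem frame_neg_basisVec (k : Fin n) : (quantumSeed B d Λ t.1).M (-basisVec (Sum.inl k)) =
    evalYHat B d Λ (recFHatInv B d Λ t k) *
      frame0 B d Λ (gExtMap B t (-basisVec (Sum.inl k))) := by
  have h0 := isToricFrame_frame0 hB hΛ
  have h1 : (quantumSeed B d Λ t.1).M (basisVec (Sum.inl k)) = _ := hF k
  rw [hM.map_neg, h1, mul_inv_rev, ← h0.map_neg, ← map_inv₀, frame0_mul_evalYHat hB hΛ, map_inv₀,
    map_neg, gExtMap_basisVec]
  rfl

theorem frame_smul_basisVec (i : Fin n) (r : ℕ) :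
    (quantumSeed B d Λ t.1).M ((r : ℤ) • basisVec (Sum.inl i)) =
      evalYHat B d Λ (List.ofFn fun l : Fin r =>
        twist B d ((l : ℤ) • gVector B t i) (quantumF B d Λ t i)).prod *
      frame0 B d Λ (gExtMap B t ((r : ℤ) • basisVec (Sum.inl i))) := by
  have h1 : (quantumSeed B d Λ t.1).M (basisVec (Sum.inl i)) = _ := hF i
  rw [hM.map_nsmul, h1, evalYHat_mul_frame0_pow hB hΛ, map_smul, gExtMap_basisVec]
  rfl

/-- Appending X_i^{a_i} moves M₀ of the previous prefix past G_i. The twist is by -g_k + ∑_{j<i} a_j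
g_j, exactly the one in F̂_i. -/
theorem frame_prefixVec (ε : ℤ) (k : Fin n) {m : ℕ} (hm : m ≤ n) :
    (quantumSeed B d Λ t.1).M (prefixVec k (exchPos B d Λ ε t k) m) =
      QSkewField.qHalf (lambda0 B d Λ) ^
        (-∑ i ∈ Finset.univ.filter fun i : Fin n => i.val < m,
          rhoForm B d Λ t Ω (prefixVec k (exchPos B d Λ ε t k) i.val)
            (exchPos B d Λ ε t k (Sum.inl i) • basisVec (Sum.inl i))) *
      (evalYHat B d Λ (recFHatInv B d Λ t k *
          ((List.ofFn fun i : Fin n => recFHat B d Λ ε t k i).take m).prod) *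
        frame0 B d Λ (gExtMap B t (prefixVec k (exchPos B d Λ ε t k) m))) := by
  induction m with
  | zero => simpa [prefixVec] using frame_neg_basisVec hB hΛ hM hF k
  | succ m ih =>
    obtain ⟨i, rfl⟩ : ∃ i : Fin n, i.val = m := ⟨⟨m, hm⟩, rfl⟩
    have ha : ((exchPos B d Λ ε t k (Sum.inl i)).toNat : ℤ) = exchPos B d Λ ε t k (Sum.inl i) :=
      Int.toNat_of_nonneg (le_max_right _ _)
    have h1 := frame_smul_basisVec hB hΛ hM hF i (exchPos B d Λ ε t k (Sum.inl i)).toNat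
    rw [ha] at h1
    have h2 := frame_add hB hΛ hM (ih i.isLt.le) h1
    rw [gExtMap_prefixVec_inl] at h2
    rw [prefixVec_succ, h2, filter_val_lt_succ, Finset.sum_insert (by simp), List.prod_take_succ _ _
      (by simp), List.getElem_ofFn, ← mul_assoc (recFHatInv B d Λ t k)]
    congr 2
    ring

/-- The expansion of the exchange monomials. -/
theorem frame_exchange (ε : ℤ) (k : Fin n) :
    (quantumSeed B d Λ t.1).M (-basisVec (Sum.inl k) + exchPos B d Λ ε t k) =
      QSkewField.qHalf (lambda0 B d Λ) ^ twoRho B d Λ ε t k *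
      (evalYHat B d Λ (recFHatInv B d Λ t k *
          (List.ofFn fun i : Fin n => recFHat B d Λ ε t k i).prod) *
        frame0 B d Λ (gExtMap B t (-basisVec (Sum.inl k) + exchPos B d Λ ε t k))) := by
  have h1 := frame_prefixVec hB hΛ hM hF ε k le_rfl
  rw [filter_val_lt_card, List.take_of_length_le (by simp)] at h1
  set a := exchPos B d Λ ε t k with ha
  -- The frozen monomial is the initial one, so its F-part is 1 and appending it introduces no
  -- twisted factor.
  have h2 : (quantumSeed B d Λ t.1).M (∑ j, a (Sum.inr j) • basisVec (Sum.inr j)) =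
      evalYHat B d Λ 1 *
        frame0 B d Λ (gExtMap B t (∑ j, a (Sum.inr j) • basisVec (Sum.inr j))) := by
    rw [quantumSeed_M_of_eq_zero _ (by simp), map_one, one_mul, map_sum]
    simp only [map_smul, gExtMap_basisVec]
    rfl
  have h3 := frame_add hB hΛ hM h1 h2
  rw [prefixVec_card_add, map_one, mul_one,
    rhoForm_sum_eq (rhoForm_skew hB hΛ hM)] at h3
  rw [h3]
  simp only [twoRho, rho_eq_rhoForm hM, ha]

end Frame

/-! ### The recurrence along an edge; existence and uniqueness -/

variable (hd : ∀ i, 0 < d i)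
include hd

/-- The final exponent is B̃⁰a + g_{k;t'} with a the frozen part; splitting M₀ there produces Z^a
and the factor q^(-λ^ε). -/
theorem evalYHat_recTerm {k : Fin n} {t t' : TreeVertex n} (he : TreeVertex.Edge k t t')
    (hF : ∀ j, IsQuantumF B d Λ t j (quantumF B d Λ t j)) {ε : ℤ} (hε : ε = 1 ∨ ε = -1) :
    evalYHat B d Λ (recTerm B d Λ ε t t' k) *
        frame0 B d Λ (gVectorExt B t' (Sum.inl k)) =
      (quantumSeed B d Λ t.1).M
        (-basisVec (Sum.inl k) + posColumn ε (quantumSeed B d Λ t.1).b k) := by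
  obtain ⟨Ω, hM, -⟩ := exists_form hB hΛ hd t.1
  have hq := isQuantumParam_qHalf (lambda0 B d Λ)
  have h1 : (quantumSeed B d Λ t.1).M
      (-basisVec (Sum.inl k) + posColumn ε (quantumSeed B d Λ t.1).b k) = _ :=
    frame_exchange hB hΛ hM hF ε k
  have h2 : gExtMap B t (-basisVec (Sum.inl k) + exchPos B d Λ ε t k) =
      (principalMatrix B *ᵥ fun j => exchPos B d Λ ε t k (Sum.inr j)) +
        gVectorExt B t' (Sum.inl k) := by
    rw [gExtMap_eq_add]
    have h3 : gDegree B t (-basisVec (Sum.inl k) + exchPos B d Λ ε t k) = gVector B t' k :=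
      (gVector_edge hB hΛ hd he hε).symm
    rw [h3]
    congr 2
    ext j
    simp
  rw [h1, h2, (isToricFrame_frame0 hB hΛ).map_add hq, form0_principal, recTerm, map_mul, map_mul,
    map_mul, map_zpow₀, evalYHat_qHalf, evalYHat_zMon, map_mul, hq.mul_zpow_mul,
    hq.zpow_mul_zpow_mul, sub_eq_add_neg]
  simp only [twoLambda, mul_assoc]
  rfl

theorem isQuantumF_edge {k : Fin n} {t t' : TreeVertex n} (he : TreeVertex.Edge k t t')
    (hF : ∀ j, IsQuantumF B d Λ t j (quantumF B d Λ t j)) :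
    IsQuantumF B d Λ t' k (recTerm B d Λ 1 t t' k + recTerm B d Λ (-1) t t' k) := by
  rw [IsQuantumF, map_add, add_mul, evalYHat_recTerm hB hΛ hd he hF (Or.inl rfl),
    evalYHat_recTerm hB hΛ hd he hF (Or.inr rfl), clusterVar_edge hB hΛ hd he]

theorem isQuantumF_edge_of_ne {k : Fin n} {t t' : TreeVertex n} (he : TreeVertex.Edge k t t')
    {j : Fin n} (hj : j ≠ k) {F : ZField B d} (hF : IsQuantumF B d Λ t j F) :
    IsQuantumF B d Λ t' j F := by
  have hg : gVectorExt B t' (Sum.inl j) = gVectorExt B t (Sum.inl j) :=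
    congrArg (fun g => (Sum.elim g 0 : Idx n → ℤ)) (gVector_edge_of_ne hB hΛ hd he hj)
  rw [IsQuantumF, clusterVar_edge_of_ne he hj, hg]
  exact hF

omit hd in
theorem IsQuantumF.unique {t : TreeVertex n} {j : Fin n} {F F' : ZField B d}
    (hF : IsQuantumF B d Λ t j F) (hF' : IsQuantumF B d Λ t j F') : F = F' := by
  rw [IsQuantumF] at hF hF'
  exact (evalYHat B d Λ).injective
    (mul_right_cancel₀ ((isToricFrame_frame0 hB hΛ).ne_zero _) (hF.symm.trans hF'))

omit hB hΛ hd in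
theorem isQuantumF_root (j : Fin n) : IsQuantumF B d Λ (TreeVertex.root n) j 1 := by
  have h : gVectorExt B (TreeVertex.root n) (Sum.inl j) = Pi.single (Sum.inl j) 1 := by
    change Sum.elim (gVector B (TreeVertex.root n) j) 0 = _
    rw [gVector_root]
    ext i
    rcases i with i | i <;> simp [Pi.single_apply]
  rw [IsQuantumF, map_one, one_mul, h]
  rfl

/-- `quantumF` is a choice, so a solution must be shown to exist: it is inherited or given by the
recurrence when a letter is prepended to the reduced word. -/
theorem isQuantumF_quantumF (t : TreeVertex n) (j : Fin n) :
    IsQuantumF B d Λ t j (quantumF B d Λ t j) := by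
  refine Classical.epsilon_spec ?_
  obtain ⟨w, hw⟩ := t
  induction w generalizing j with
  | nil => exact ⟨1, isQuantumF_root j⟩
  | cons k w ih =>
    have he : TreeVertex.Edge k (⟨w, hw.of_cons⟩ : TreeVertex n) ⟨k :: w, hw⟩ := Or.inl rfl
    by_cases hj : j = k
    · subst hj
      exact ⟨_, isQuantumF_edge hB hΛ hd he fun i => Classical.epsilon_spec (ih i hw.of_cons)⟩
    · obtain ⟨F, hF⟩ := ih j hw.of_cons
      exact ⟨F, isQuantumF_edge_of_ne hB hΛ hd he hj hF⟩

end Recurrence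

end QCA

end

theorem mainTheorem2 {n : ℕ} (B : Matrix (Fin n) (Fin n) ℤ) (d : Fin n → ℤ)
    (hd : ∀ i, 0 < d i)
    (hB : (Matrix.diagonal d * B).transpose = -(Matrix.diagonal d * B))
    (Λ : Matrix (Fin n) (Fin n) ℤ) (hΛ : Λ.transpose = -Λ) :
    (∀ (t : QCA.TreeVertex n) (j : Fin n) (F : QCA.ZField B d),
      QCA.IsQuantumF B d Λ t j F ↔ F = QCA.quantumF B d Λ t j) ∧
    (∀ j : Fin n, QCA.quantumF B d Λ (QCA.TreeVertex.root n) j = 1) ∧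
    ∀ (k : Fin n) (t t' : QCA.TreeVertex n), QCA.TreeVertex.Edge k t t' →
      (∀ j : Fin n, j ≠ k → QCA.quantumF B d Λ t' j = QCA.quantumF B d Λ t j) ∧
      QCA.quantumF B d Λ t' k =
        QCA.recTerm B d Λ 1 t t' k + QCA.recTerm B d Λ (-1) t t' k := by
  -- With this, each claim follows from uniqueness once the proposed value is known to satisfy the
  -- defining equation.
  have hF := QCA.isQuantumF_quantumF hB hΛ hd
  refine ⟨fun t j F => ⟨fun h => h.unique hB hΛ (hF t j), fun h => h ▸ hF t j⟩,
    fun j => (hF _ j).unique hB hΛ (QCA.isQuantumF_root j), fun k t t' he => ⟨fun j hj => ?_, ?_⟩⟩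
  · exact (hF t' j).unique hB hΛ (QCA.isQuantumF_edge_of_ne hB hΛ hd he hj (hF t j))
  · exact (hF t' k).unique hB hΛ (QCA.isQuantumF_edge hB hΛ hd he (hF t))
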